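/- Let $\mathbb K\in\{\mathbb R,\mathbb C\}$, $a<b$, and consider the boundary control system on $[a,b]$ $$\partial_t x=P_1\partial_\xi(\mathcal Hx)+P_0(\mathcal Hx),\qquad u(t)=\widetilde W_B\begin{bmatrix}(\mathcal Hx)(b,t)\\(\mathcal Hx)(a,t)\end{bmatrix},\qquad y(t)=\widetilde W_C\begin{bmatrix}(\mathcal Hx)(b,t)\\(\mathcal Hx)(a,t)\end{bmatrix},$$ where $P_1\in\mathbb K^{n\times n}$ is invertible and self-adjoint; $P_0,\mathcal H\in L^\infty([a,b],\mathbb K^{n\times n})$; $\mathcal H(\xi)$ is self-adjoint with $c_1I\le\mathcal H(\xi)\le c_2I$ for almost all $\xi$ and some constants $c_1,c_2>0$; $\widetilde W_B\in\mathbb K^{n\times 2n}$ and $\begin{bmatrix}\widetilde W_B\\\widetilde W_C\end{bmatrix}\in\mathbb K^{2n\times2n}$ have full rank; and the operator $A=P_1\partial_\xi\mathcal H+P_0\mathcal H$ with domain $\{x\in L^2([a,b],\mathbb K^n): \mathcal Hx\in H^1,\ \widetilde W_B\begin{bmatrix}(\mathcal Hx)(b)\\(\mathcal Hx)(a)\end{bmatrix}=0\}$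 generates a $C_0$-semigroup on $L^2([a,b],\mathbb K^n)$. Assume that there are $S,\mathcal H^D\in C^1([a,b],\mathbb K^{n\times n})$, with $S$ pointwise invertible and $\mathcal H^D$ diagonal with positive diagonal entries, and $0\le m\le n$ such that $P_1\mathcal H=S^{-1}P_1^D\mathcal H^DS$ with $P_1^D=\operatorname{diag}(I_m,-I_{n-m})$, and that $P_0^D:=S\big[(S^{-1})'+P_0P_1^{-1}S^{-1}\big]P_1^D$ vanishes almost everywhere on $[a,b]$. The diagonalised system is the system of the above form with coefficients $P_1^D$, $P_0^D=0$, $\mathcal H^D$, $\widetilde W_B^D=\widetilde W_BR$, $\widetilde W_C^D=\widetilde W_CR$, where $R=\operatorname{diag}\big(P_1^{-1}S(b)^{-1}P_1^D,\;P_1^{-1}S(a)^{-1}P_1^D\big)$. For the diagonalised system let $Q_+=\operatorname{diag}(I_m,0)$ and $Q_-=\operatorname{diag}(0,I_{n-m})$ (the positive square roots of $\pm P_1^D$ on its positive, respectively negative, spectral subspace, extended by $0$), let $\Psi^s_\zeta$ be the fundamental solution of $v'=s(P_1^D)^{-1}(\mathcal H^D)^{-1}v$ on $[a,b]$ with $\Psi^s_a=I$,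 and let $\mathbf U(s)=(Q_++Q_-\Psi^s_b)(Q_-+Q_+\Psi^s_b)^{-1}$. For a function $g$ of a complex variable, $\|g\|_{\mathcal M}$ denotes the total variation of the complex Borel measure of bounded variation on $[0,\infty)$ whose Laplace transform agrees with $g$ on some right half-plane ($\infty$ if there is none). $|M|$ denotes the matrix with entries $|M_{ij}|$. A system is called BIBO stable if there is $c>0$ such that $\|y\|_{L^\infty[0,t]}\le c\,\|u\|_{L^\infty[0,t]}$ for all $t>0$ and all classical solutions $(u,x,y)$ (that is, $u,y$ continuous, $x\in C^1([0,\infty),L^2([a,b],\mathbb K^n))$) with $u\in C_c^\infty([0,\infty),\mathbb K^n)$ and $x(0)=0$. **Theorem.** There are matrices $K,M\in\mathbb K^{n\times n}$ with $K$ invertible and $\widetilde W_B^D=K\begin{pmatrix}Q_+-MQ_-&Q_--MQ_+\end{pmatrix}$. For any such $K,M$, if at least one of the conditions 1. $\|M\|_{\ell^\infty\to\ell^\infty}<1$; 2. $\sum_{k=0}^\infty|M|^k$ converges; 3. there is $k_0>0$ such that $\sum_{r=1}^n\big\|\big((M\mathbf U(s))^{k_0}\big)_{p,r}\big\|_{\mathcal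 M}<1$ for all $1\le p\le n$ holds, then $\sum_{k=0}^\infty\big\|\big((M\mathbf U(s))^{k}\big)_{p,q}\big\|_{\mathcal M}<\infty$ for all $1\le p,q\le n$, and both the diagonalised system and the original system are BIBO stable. Moreover, condition 2 holds whenever $\|\,|M|\,\|<1$ for some submultiplicative norm on $\mathbb K^{n\times n}$. -/

import Mathlib

open MeasureTheory Set Filter Topology Matrix
open scoped NNReal ENNReal ContDiff ComplexOrder

noncomputable section

/-! ### Strongly continuous semigroups -/

/-- The linear operator with graph `G` (`G x y` means `x ∈ D(A)` and `A x = y`) is the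
infinitesimal generator of a strongly continuous one-parameter semigroup on `X`. -/
def GeneratesC0Semigroup (𝕜 : Type*) [RCLike 𝕜] {X : Type*} [NormedAddCommGroup X]
    [NormedSpace 𝕜 X] (G : X → X → Prop) : Prop :=
  ∃ T : ℝ≥0 → X →L[𝕜] X,
    T 0 = 1 ∧ (∀ s t, T (s + t) = T s * T t) ∧ (∀ x, Continuous fun t => T t x) ∧
    ∀ x y, G x y ↔ Tendsto (fun t : ℝ≥0 => ((t : ℝ) : 𝕜)⁻¹ • (T t x - x)) (𝓝[>] 0) (𝓝 y)

/-! ### Inverse Laplace transforms and their total variation -/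

/-- `μ` is a complex Borel measure of bounded total variation on `[0, ∞)` whose Laplace transform
agrees with `g` on some right half-plane. The half-plane may be shrunk, so it is taken inside
`{Re s > 0}`, where the integral always converges. -/
def IsInverseLaplace (μ : ComplexMeasure ℝ≥0) (g : ℂ → ℂ) : Prop :=
  μ.variation univ ≠ ⊤ ∧ ∃ α : ℝ, 0 ≤ α ∧ ∀ s : ℂ, α < s.re →
    μ.integral (fun t : ℝ≥0 => Complex.exp (-s * ((t : ℝ) : ℂ))) (ContinuousLinearMap.mul ℝ ℂ) = g s

/-- The total variation of the inverse Laplace transform of `g`. The inverse transform is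
unique if it exists, so the infimum is over at most one measure; the value is `∞` if `g` is not the
Laplace transform of a measure of bounded total variation. -/
def laplaceVariation (g : ℂ → ℂ) : ℝ≥0∞ :=
  ⨅ (μ : ComplexMeasure ℝ≥0) (_ : IsInverseLaplace μ g), μ.variation univ

/-! ### Matrix notions -/

/-- The norm of `M` as an operator from `ℓ^∞` to `ℓ^∞`
(the norm of `Fin n → 𝕜` is the maximum norm). -/
def normInftyInfty {𝕜 : Type*} [RCLike 𝕜] {n : ℕ} (M : Matrix (Fin n) (Fin n) 𝕜) : ℝ :=
  ‖LinearMap.toContinuousLinearMap (Matrix.mulVecLin M)‖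

/-- The matrix of the absolute values of the entries. -/
def absMatrix {𝕜 : Type*} [RCLike 𝕜] {n : ℕ} (M : Matrix (Fin n) (Fin n) 𝕜) :
    Matrix (Fin n) (Fin n) 𝕜 :=
  M.map fun z => ((‖z‖ : ℝ) : 𝕜)

/-- Entrywise inclusion of `𝕜`, which is `ℝ` or `ℂ`, into `ℂ`. -/
def complexify {𝕜 : Type*} [RCLike 𝕜] {n : ℕ} (M : Matrix (Fin n) (Fin n) 𝕜) :
    Matrix (Fin n) (Fin n) ℂ :=
  M.map (RCLike.map 𝕜 ℂ)

/-! ### Hyperbolic boundary control systems -/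

/-- The data of the system
`∂ₜ x = P₁ ∂_ξ (H x) + P₀ (H x)` on `[a, b]`,
`u = W_B [(H x)(b); (H x)(a)]`, `y = W_C [(H x)(b); (H x)(a)]`. -/
structure HBCS (𝕜 : Type*) [RCLike 𝕜] (n : ℕ) where
  a : ℝ
  b : ℝ
  hab : a < b
  P1 : Matrix (Fin n) (Fin n) 𝕜
  P0 : ℝ → Matrix (Fin n) (Fin n) 𝕜
  H : ℝ → Matrix (Fin n) (Fin n) 𝕜
  WB : Matrix (Fin n) (Fin n ⊕ Fin n) 𝕜
  WC : Matrix (Fin n) (Fin n ⊕ Fin n) 𝕜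

namespace HBCS

variable {𝕜 : Type*} [RCLike 𝕜] {n : ℕ} (sys : HBCS 𝕜 n)

/-- Lebesgue measure on `[a, b]`. -/
abbrev vol : Measure ℝ := volume.restrict (Icc sys.a sys.b)

/-- The state space `L²([a, b], 𝕜ⁿ)`. Since `m I ≤ H ≤ M I`, the inner product weighted by `H`
induces an equivalent norm, so that strong continuity, generators and differentiability are the
same for both. -/
abbrev State : Type _ := Lp (EuclideanSpace 𝕜 (Fin n)) 2 sys.vol

/-- The vector `[v(b); v(a)]` of boundary values. -/
def trace (v : ℝ → EuclideanSpace 𝕜 (Fin n)) : Fin n ⊕ Fin n → 𝕜 :=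
  Sum.elim (v sys.b).ofLp (v sys.a).ofLp

/-- `v ∈ H¹([a, b], 𝕜ⁿ)` (as its continuous representative) with weak derivative `w ∈ L²`. -/
def HasH1Deriv (v w : ℝ → EuclideanSpace 𝕜 (Fin n)) : Prop :=
  MemLp w 2 sys.vol ∧ ∀ ξ ∈ Icc sys.a sys.b, v ξ = v sys.a + ∫ ζ in sys.a..ξ, w ζ

/-- `H x ∈ H¹` with continuous representative `v`, and `P₁ ∂_ξ (H x) + P₀ (H x) = z`. -/
def Evolution (x z : sys.State) (v : ℝ → EuclideanSpace 𝕜 (Fin n)) : Prop :=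
  ∃ w : ℝ → EuclideanSpace 𝕜 (Fin n), sys.HasH1Deriv v w ∧
    (∀ᵐ ξ ∂sys.vol, (v ξ).ofLp = sys.H ξ *ᵥ (x ξ).ofLp) ∧
    (∀ᵐ ξ ∂sys.vol, (z ξ).ofLp = sys.P1 *ᵥ (w ξ).ofLp + sys.P0 ξ *ᵥ (v ξ).ofLp)

/-- The graph of the operator `A = P₁ ∂_ξ H + P₀ H` with domain
`{x | H x ∈ H¹, W_B [(H x)(b); (H x)(a)] = 0}`. -/
def operatorGraph (x z : sys.State) : Prop :=
  ∃ v : ℝ → EuclideanSpace 𝕜 (Fin n), sys.Evolution x z v ∧ sys.WB *ᵥ sys.trace v = 0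

/-- The standing assumptions on the system. -/
structure Admissible : Prop where
  P1_unit : IsUnit sys.P1
  P1_selfAdjoint : sys.P1.IsHermitian
  P0_bounded : ∀ i j, MemLp (fun ξ => sys.P0 ξ i j) ⊤ sys.vol
  H_bounded : ∀ i j, MemLp (fun ξ => sys.H ξ i j) ⊤ sys.vol
  H_selfAdjoint : ∀ᵐ ξ ∂sys.vol, (sys.H ξ).IsHermitian
  H_bounds : ∃ m M : ℝ, 0 < m ∧ 0 < M ∧ ∀ᵐ ξ ∂sys.vol,
    (sys.H ξ - (m : 𝕜) • (1 : Matrix (Fin n) (Fin n) 𝕜)).PosSemidef ∧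
    ((M : 𝕜) • (1 : Matrix (Fin n) (Fin n) 𝕜) - sys.H ξ).PosSemidef
  WB_rank : sys.WB.rank = n
  WBC_rank : (Matrix.fromRows sys.WB sys.WC).rank = n + n
  generates : GeneratesC0Semigroup 𝕜 sys.operatorGraph

/-- `(u, x, y)` is a classical solution on `[0, ∞)`: `u`, `y` are continuous, `x` is `C¹` with
values in the state space, and the equations hold for every `t ≥ 0`. -/
def IsClassicalSolution (u : ℝ → EuclideanSpace 𝕜 (Fin n)) (x : ℝ → sys.State)
    (y : ℝ → EuclideanSpace 𝕜 (Fin n)) : Prop :=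
  ContinuousOn u (Ici 0) ∧ ContDiffOn ℝ 1 x (Ici 0) ∧ ContinuousOn y (Ici 0) ∧
    ∀ t, 0 ≤ t → ∃ v : ℝ → EuclideanSpace 𝕜 (Fin n),
      sys.Evolution (x t) (derivWithin x (Ici 0) t) v ∧
      (u t).ofLp = sys.WB *ᵥ sys.trace v ∧ (y t).ofLp = sys.WC *ᵥ sys.trace v

/-- BIBO stability: a uniform bound `‖y‖_{L^∞[0,t]} ≤ c ‖u‖_{L^∞[0,t]}` for all classical solutions
with `u ∈ C_c^∞([0, ∞))` and `x(0) = 0`. -/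
def BIBOStable : Prop :=
  ∃ c : ℝ, 0 < c ∧ ∀ u x y, sys.IsClassicalSolution u x y →
    ContDiffOn ℝ ∞ u (Ici 0) → (∃ R : ℝ, ∀ t, R < t → u t = 0) → x 0 = 0 →
    ∀ t : ℝ, 0 < t →
      eLpNorm y ⊤ (volume.restrict (Icc 0 t)) ≤
        ENNReal.ofReal c * eLpNorm u ⊤ (volume.restrict (Icc 0 t))

/-! ### Decomposition of the input matrix, fundamental solution -/

/-- `Q₊`: the square root of `P₁` on the span of the eigenvectors with positive eigenvalue, zero on
the span of those with negative eigenvalue (`√r = 0` for `r ≤ 0`). -/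
def Qplus : Matrix (Fin n) (Fin n) 𝕜 := cfc (fun r : ℝ => Real.sqrt r) sys.P1

/-- `Q₋`: the square root of `-P₁` on the span of the eigenvectors with negative eigenvalue, zero on
the span of those with positive eigenvalue. -/
def Qminus : Matrix (Fin n) (Fin n) 𝕜 := cfc (fun r : ℝ => Real.sqrt (-r)) sys.P1

/-- `W_B = K (Q₊ - M Q₋, Q₋ - M Q₊)` with `K` invertible. -/
def IsDecomposition (K M : Matrix (Fin n) (Fin n) 𝕜) : Prop :=
  IsUnit K ∧ sys.WB =
    K * Matrix.fromCols (sys.Qplus - M * sys.Qminus) (sys.Qminus - M * sys.Qplus)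

/-- `Ψ` is the fundamental solution on `[a, b]`, `Ψ(a) = I`, of
`v' = -P₁⁻¹ (P₀ - s H⁻¹) v`; as the coefficients are only bounded and measurable,
the equation is understood in integrated form. -/
def IsFundamentalSolution (s : ℂ) (Ψ : ℝ → Matrix (Fin n) (Fin n) ℂ) : Prop :=
  ContinuousOn Ψ (Icc sys.a sys.b) ∧ ∀ ζ ∈ Icc sys.a sys.b, ∀ i j,
    Ψ ζ i j = (1 : Matrix (Fin n) (Fin n) ℂ) i j +
      ∫ τ in sys.a..ζ, (-(complexify sys.P1)⁻¹ *
        (complexify (sys.P0 τ) - s • (complexify (sys.H τ))⁻¹) * Ψ τ) i j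

/-- The fundamental solution `Ψ_ζ^s` (it exists and is unique on `[a, b]`). -/
def fundamentalSolution (s : ℂ) : ℝ → Matrix (Fin n) (Fin n) ℂ :=
  Classical.epsilon (sys.IsFundamentalSolution s)

/-- `V(s) = Q₋ + Q₊ Ψ_b^s`. -/
def V (s : ℂ) : Matrix (Fin n) (Fin n) ℂ :=
  complexify sys.Qminus + complexify sys.Qplus * sys.fundamentalSolution s sys.b

/-- `U(s) = (Q₊ + Q₋ Ψ_b^s) V(s)⁻¹`. -/
def U (s : ℂ) : Matrix (Fin n) (Fin n) ℂ :=
  (complexify sys.Qplus + complexify sys.Qminus * sys.fundamentalSolution s sys.b) * (sys.V s)⁻¹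

/-- The total variation of the inverse Laplace transform of the `(p, q)` entry of
`(M U(s))^k`. -/
def powVariation (M : Matrix (Fin n) (Fin n) 𝕜) (k : ℕ) (p q : Fin n) : ℝ≥0∞ :=
  laplaceVariation fun s => ((complexify M * sys.U s) ^ k) p q

/-! ### Diagonalisation -/

/-- `P₁^D = diag(I_m, -I_{n-m})`. -/
def P1D (𝕜 : Type*) [RCLike 𝕜] (n m : ℕ) : Matrix (Fin n) (Fin n) 𝕜 :=
  Matrix.diagonal fun i => if (i : ℕ) < m then 1 else -1

/-- A `C¹` diagonalisation `P₁ H = S⁻¹ P₁^D H^D S`, where `S` is pointwise invertible and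
`H^D = diag(h₁, …, hₙ)` is positive. -/
structure Diagonalisation where
  m : ℕ
  m_le : m ≤ n
  S : ℝ → Matrix (Fin n) (Fin n) 𝕜
  h : ℝ → Fin n → ℝ
  S_contDiff : ∀ i j, ContDiffOn ℝ 1 (fun ξ => S ξ i j) (Icc sys.a sys.b)
  S_unit : ∀ ξ ∈ Icc sys.a sys.b, IsUnit (S ξ)
  h_contDiff : ∀ i, ContDiffOn ℝ 1 (fun ξ => h ξ i) (Icc sys.a sys.b)
  h_pos : ∀ ξ ∈ Icc sys.a sys.b, ∀ i, 0 < h ξ i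
  eq : ∀ᵐ ξ ∂sys.vol, sys.P1 * sys.H ξ =
    (S ξ)⁻¹ * P1D 𝕜 n m * Matrix.diagonal (fun i => (h ξ i : 𝕜)) * S ξ

variable {sys}

namespace Diagonalisation

variable (D : sys.Diagonalisation)

/-- The entrywise derivative of `ξ ↦ S(ξ)⁻¹` on `[a, b]`. -/
def derivSInv (ξ : ℝ) : Matrix (Fin n) (Fin n) 𝕜 :=
  Matrix.of fun i j => derivWithin (fun ζ => (D.S ζ)⁻¹ i j) (Icc sys.a sys.b) ξ

/-- `P₀^D = S [(S⁻¹)' + P₀ P₁⁻¹ S⁻¹] P₁^D`. -/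
def P0D (ξ : ℝ) : Matrix (Fin n) (Fin n) 𝕜 :=
  D.S ξ * (D.derivSInv ξ + sys.P0 ξ * sys.P1⁻¹ * (D.S ξ)⁻¹) * P1D 𝕜 n D.m

/-- The block diagonal matrix `diag(P₁⁻¹ S⁻¹(b) P₁^D, P₁⁻¹ S⁻¹(a) P₁^D)`. -/
def boundaryTransform : Matrix (Fin n ⊕ Fin n) (Fin n ⊕ Fin n) 𝕜 :=
  Matrix.fromBlocks (sys.P1⁻¹ * (D.S sys.b)⁻¹ * P1D 𝕜 n D.m) 0
    0 (sys.P1⁻¹ * (D.S sys.a)⁻¹ * P1D 𝕜 n D.m)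

/-- The diagonalised system, obtained by the state transformation `x ↦ S x`. -/
def system : HBCS 𝕜 n where
  a := sys.a
  b := sys.b
  hab := sys.hab
  P1 := P1D 𝕜 n D.m
  P0 := D.P0D
  H := fun ξ => Matrix.diagonal fun i => (D.h ξ i : 𝕜)
  WB := sys.WB * D.boundaryTransform
  WC := sys.WC * D.boundaryTransform

end Diagonalisation

end HBCS

end

noncomputable section

/-!
Let `τ i = ∫ 1 / h i` be the travel time along the `i`-th characteristic. As `P0D = 0`, the
diagonalised system is a family of decoupled transport equations, and `U s = diag (e^{-s τ i})`.
Hence the entries of `(M U)^k` are exponential polynomials `∑ c_d e^{-s d}`, that is, Laplace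
transforms of `∑ c_d δ_d`, and their variation is the `ℓ¹` norm of the coefficients. Since this norm
is submultiplicative, each of the three conditions makes the powers of `M U` summable.

For a trajectory starting at `0`, testing the evolution equation with functions transported along
the characteristics shows that the outflow at time `t` is the inflow at time `t - τ`. In these
boundary variables the decomposition of `WB` says `inflow = K⁻¹ u + M * outflow`, so the inflow
solves a delay equation. Its Neumann series is a finite sum at each time, because the delays are
bounded below, and is bounded by the summable powers of `M U`; the output is a function of inflow
and outflow.

If no decomposition existed, then some nonzero functional of the outflow would vanish on the domain
of the generator. Pairing an orbit of the semigroup with transported test functions which have not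
left the interval yet then gives a nonzero vector orthogonal to the dense domain.
-/

/-! ### Summable powers -/

section NormedRing

variable {R : Type*} [NormedRing R]

lemma summable_norm_pow_of_norm_pow_lt_one {a : R} {k : ℕ} (hk : 0 < k) (ha : ‖a ^ k‖ < 1) :
    Summable fun j : ℕ => ‖a ^ j‖ := by
  have : NeZero k := ⟨hk.ne'⟩
  rw [← (Nat.divModEquiv k).symm.summable_iff]
  have hgeom : Summable fun j : ℕ => ‖(a ^ k) ^ j‖ := by
    refine summable_of_ratio_norm_eventually_le (r := ‖a ^ k‖) ha (.of_forall fun j => ?_)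
    simpa only [norm_norm, pow_succ'] using norm_mul_le (a ^ k) ((a ^ k) ^ j)
  refine (hgeom.mul_of_nonneg (g := fun r : Fin k => ‖a ^ (r : ℕ)‖) (.of_finite ..)
    (fun _ => norm_nonneg _) fun _ => norm_nonneg _).of_nonneg_of_le
    (fun _ => norm_nonneg _) fun ⟨j, r⟩ => ?_
  simpa only [Function.comp_apply, Nat.divModEquiv_symm_apply, pow_add, pow_mul', pow_right_comm]
    using norm_mul_le ((a ^ k) ^ j) (a ^ (r : ℕ))

variable {ι : Type*} [Fintype ι]

open scoped Matrix.Norms.Operator in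
lemma sum_norm_row_le_linfty_opNorm {ι' α : Type*} [Fintype ι'] [SeminormedAddCommGroup α]
    (A : Matrix ι' ι α) (p : ι') : ∑ r, ‖A p r‖ ≤ ‖A‖ := by
  have h : ∑ r, ‖A p r‖₊ ≤ ‖A‖₊ :=
    (Finset.le_sup (f := fun p => ∑ r, ‖A p r‖₊) (Finset.mem_univ p)).trans_eq
      (Matrix.linfty_opNNNorm_def A).symm
  simpa only [← NNReal.coe_le_coe, NNReal.coe_sum, coe_nnnorm] using h

variable [DecidableEq ι]

open scoped Matrix.Norms.Operator in
lemma summable_norm_matrix_pow_apply {A : Matrix ι ι R} {k : ℕ} (hk : 0 < k)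
    (hA : ∀ p, ∑ r, ‖(A ^ k) p r‖ < 1) (p q : ι) : Summable fun j : ℕ => ‖(A ^ j) p q‖ := by
  have hlt : ‖A ^ k‖₊ < 1 := by
    rw [Matrix.linfty_opNNNorm_def, Finset.sup_lt_iff one_pos]
    exact fun p _ => by
      simpa only [← NNReal.coe_lt_coe, NNReal.coe_sum, coe_nnnorm, NNReal.coe_one] using hA p
  refine (summable_norm_pow_of_norm_pow_lt_one hk hlt).of_nonneg_of_le (fun _ => norm_nonneg _)
    fun j => ?_
  exact (Finset.single_le_sum (f := fun r => ‖(A ^ j) p r‖) (fun _ _ => norm_nonneg _)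
    (Finset.mem_univ q)).trans (sum_norm_row_le_linfty_opNorm _ p)

lemma norm_matrix_pow_apply_le [NormOneClass R] (A : Matrix ι ι R) (k : ℕ) (p q : ι) :
    ‖(A ^ k) p q‖ ≤ (A.map (‖·‖) ^ k) p q := by
  induction k generalizing q with
  | zero => rcases eq_or_ne p q with rfl | h <;> simp [*]
  | succ k ih =>
    simp only [pow_succ, Matrix.mul_apply]
    refine (norm_sum_le _ _).trans (Finset.sum_le_sum fun r _ => (norm_mul_le _ _).trans ?_)
    exact mul_le_mul_of_nonneg_right (ih r) (norm_nonneg _)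

lemma algebraNorm_entry_le {𝕜 : Type*} [NormedField 𝕜] (ν : AlgebraNorm 𝕜 (Matrix ι ι 𝕜))
    (p q : ι) : ∃ C : ℝ, ∀ A : Matrix ι ι 𝕜, ‖A p q‖ ≤ C * ν A := by
  set E : ι → ι → Matrix ι ι 𝕜 := fun i j => Matrix.single i j 1
  have hpos : 0 < ν (E p q) := (apply_nonneg ν _).lt_of_ne' fun h => by
    simpa [E] using congr_fun₂ (eq_zero_of_map_eq_zero ν h) p q
  refine ⟨ν (E p p) * ν (E q q) / ν (E p q), fun A => ?_⟩
  rw [div_mul_eq_mul_div, le_div_iff₀ hpos]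
  calc ‖A p q‖ * ν (E p q) = ν (E p p * A * E q q) := by
        rw [← map_smul_eq_mul ν]
        simp [E, Matrix.single_mul_mul_single, Matrix.smul_single]
    _ ≤ ν (E p p) * ν A * ν (E q q) :=
        (map_mul_le_mul ν _ _).trans
          (mul_le_mul_of_nonneg_right (map_mul_le_mul ν _ _) (apply_nonneg ν _))
    _ = ν (E p p) * ν (E q q) * ν A := by ring

lemma summable_pow_of_algebraNorm_lt_one {𝕜 : Type*} [NormedField 𝕜] [CompleteSpace 𝕜]
    {A : Matrix ι ι 𝕜} (ν : AlgebraNorm 𝕜 (Matrix ι ι 𝕜)) (hA : ν A < 1) :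
    Summable fun k : ℕ => A ^ k := by
  refine Pi.summable.mpr fun p => Pi.summable.mpr fun q => ?_
  obtain ⟨C, hC⟩ := algebraNorm_entry_le ν p q
  have hgeom : Summable fun k : ℕ => |C| * ν A ^ k :=
    (summable_geometric_of_lt_one (apply_nonneg ν _) hA).mul_left _
  refine hgeom.of_norm_bounded_eventually_nat ?_
  filter_upwards [eventually_ne_atTop 0] with k hk
  exact (hC _).trans (mul_le_mul (le_abs_self C) (map_pow_le_pow ν A hk) (apply_nonneg ν _)
    (abs_nonneg _))

end NormedRing

section AbsMatrix

variable {𝕜 : Type*} [RCLike 𝕜] {n : ℕ}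

lemma summable_absMatrix_pow_iff (M : Matrix (Fin n) (Fin n) 𝕜) :
    (Summable fun k : ℕ => absMatrix M ^ k) ↔
      ∀ p q, Summable fun k : ℕ => (M.map (‖·‖) ^ k) p q := by
  have hpow (k : ℕ) (p q) : (absMatrix M ^ k) p q = ((M.map (‖·‖) ^ k) p q : 𝕜) :=
    (congr_fun₂ (map_pow (algebraMap ℝ 𝕜).mapMatrix (M.map (‖·‖)) k) p q).symm
  refine Pi.summable.trans (forall_congr' fun p => Pi.summable.trans (forall_congr' fun q => ?_))
  simp only [hpow, RCLike.summable_ofReal]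

open scoped Matrix.Norms.Operator in
lemma sum_norm_row_le_normInftyInfty (M : Matrix (Fin n) (Fin n) 𝕜) (p : Fin n) :
    ∑ q, ‖M p q‖ ≤ normInftyInfty M :=
  (sum_norm_row_le_linfty_opNorm M p).trans_eq (Matrix.linfty_opNorm_eq_opNorm M)

lemma norm_complexify_apply (M : Matrix (Fin n) (Fin n) 𝕜) (p q : Fin n) :
    ‖complexify M p q‖ = ‖M p q‖ := by
  simp [complexify]

end AbsMatrix

/-! ### Exponential polynomials -/

section L1Norm

variable (R Γ : Type*) [NormedRing R] [AddMonoid Γ]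

/-- The `ℓ¹` norm of the coefficients on an additive monoid algebra. -/
def l1AddGroupNorm : AddGroupNorm (AddMonoidAlgebra R Γ) where
  toFun a := a.coeff.sum fun _ c => ‖c‖
  map_zero' := by simp
  add_le' a b := by
    classical
    set s := a.coeff.support ∪ b.coeff.support
    have hsum {x : AddMonoidAlgebra R Γ} (hx : x.coeff.support ⊆ s) :
        x.coeff.sum (fun _ c => ‖c‖) = ∑ d ∈ s, ‖x.coeff d‖ :=
      Finsupp.sum_of_support_subset _ hx _ fun _ _ => norm_zero
    rw [hsum (x := a + b) Finsupp.support_add, hsum Finset.subset_union_left,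
      hsum Finset.subset_union_right, ← Finset.sum_add_distrib]
    exact Finset.sum_le_sum fun d _ => norm_add_le (a.coeff d) (b.coeff d)
  neg' a := by simp [Finsupp.sum]
  eq_zero_of_map_eq_zero' a ha := by
    ext d
    by_contra hd
    exact hd (norm_eq_zero.mp ((Finset.sum_eq_zero_iff_of_nonneg fun _ _ => norm_nonneg _).mp ha d
      (Finsupp.mem_support_iff.mpr hd)))

variable {R Γ}

lemma l1AddGroupNorm_apply (a : AddMonoidAlgebra R Γ) :
    l1AddGroupNorm R Γ a = ∑ d ∈ a.coeff.support, ‖a.coeff d‖ := rfl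

lemma l1AddGroupNorm_single (d : Γ) (c : R) :
    l1AddGroupNorm R Γ (AddMonoidAlgebra.single d c) = ‖c‖ :=
  Finsupp.sum_single_index norm_zero

lemma l1AddGroupNorm_mul_le (a b : AddMonoidAlgebra R Γ) :
    l1AddGroupNorm R Γ (a * b) ≤ l1AddGroupNorm R Γ a * l1AddGroupNorm R Γ b := by
  have hsum {s : Finset Γ} (f : Γ → AddMonoidAlgebra R Γ) :
      l1AddGroupNorm R Γ (∑ d ∈ s, f d) ≤ ∑ d ∈ s, l1AddGroupNorm R Γ (f d) :=
    Finset.le_sum_of_subadditive _ (map_zero _).le (map_add_le_add _) s f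
  rw [AddMonoidAlgebra.mul_def, l1AddGroupNorm_apply a, l1AddGroupNorm_apply b, Finset.sum_mul_sum]
  refine (hsum _).trans <| Finset.sum_le_sum fun d _ => (hsum _).trans <|
    Finset.sum_le_sum fun e _ => ?_
  rw [l1AddGroupNorm_single]
  exact norm_mul_le _ _

end L1Norm

/-- The algebra of formal exponential polynomials `∑ c_d e^{-sd}` with exponents `d ≥ 0`. -/
abbrev ExpPoly : Type := AddMonoidAlgebra ℂ ℝ≥0

namespace ExpPoly

instance : NormedRing ExpPoly :=
  RingNorm.toNormedRing { l1AddGroupNorm ℂ ℝ≥0 with mul_le' := l1AddGroupNorm_mul_le }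

lemma norm_def (a : ExpPoly) : ‖a‖ = ∑ d ∈ a.coeff.support, ‖a.coeff d‖ := rfl

@[simp] lemma norm_single (d : ℝ≥0) (c : ℂ) :
    ‖(AddMonoidAlgebra.single d c : ExpPoly)‖ = ‖c‖ :=
  l1AddGroupNorm_single d c

instance : NormOneClass ExpPoly where
  norm_one := by rw [AddMonoidAlgebra.one_def, norm_single, norm_one]

/-- The value `∑ c_d e^{-sd}` of an exponential polynomial. -/
def eval (s : ℂ) : ExpPoly →ₐ[ℂ] ℂ :=
  AddMonoidAlgebra.lift ℂ ℂ ℝ≥0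
    { toFun := fun d => Complex.exp (-s * (d.toAdd : ℝ))
      map_one' := by simp
      map_mul' := fun x y => by
        simp only [toAdd_mul, NNReal.coe_add, Complex.ofReal_add, mul_add, Complex.exp_add] }

lemma eval_apply (s : ℂ) (a : ExpPoly) :
    eval s a = ∑ d ∈ a.coeff.support, a.coeff d * Complex.exp (-s * (d : ℝ)) := by
  simp [eval, AddMonoidAlgebra.lift_apply, Finsupp.sum]

@[simp] lemma eval_single (s : ℂ) (d : ℝ≥0) (c : ℂ) :
    eval s (AddMonoidAlgebra.single d c) = c * Complex.exp (-s * (d : ℝ)) := by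
  simp [eval]

/-- The action of exponential polynomials on functions of time, where `e^{-sd}` is the delay
by `d`. -/
def delay : ExpPoly →ₐ[ℂ] Module.End ℂ (ℝ → ℂ) :=
  AddMonoidAlgebra.lift ℂ (Module.End ℂ (ℝ → ℂ)) ℝ≥0
    { toFun := fun d =>
        { toFun := fun f t => f (t - (d.toAdd : ℝ))
          map_add' := fun _ _ => rfl
          map_smul' := fun _ _ => rfl }
      map_one' := by ext f; simp
      map_mul' := fun x y => by ext f t; simp [sub_sub] }

lemma delay_apply (a : ExpPoly) (f : ℝ → ℂ) (t : ℝ) :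
    delay a f t = ∑ d ∈ a.coeff.support, a.coeff d * f (t - d) := by
  simp [delay, AddMonoidAlgebra.lift_apply, Finsupp.sum, LinearMap.sum_apply, Finset.sum_apply]

@[simp] lemma delay_single (d : ℝ≥0) (c : ℂ) (f : ℝ → ℂ) (t : ℝ) :
    delay (AddMonoidAlgebra.single d c) f t = c * f (t - d) := by
  simp [delay]

lemma norm_delay_le (a : ExpPoly) {f : ℝ → ℂ} {t B : ℝ} (hf : ∀ s ≤ t, ‖f s‖ ≤ B) :
    ‖delay a f t‖ ≤ ‖a‖ * B := by
  rw [delay_apply, norm_def, Finset.sum_mul]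
  refine (norm_sum_le _ _).trans (Finset.sum_le_sum fun d _ => ?_)
  rw [norm_mul]
  exact mul_le_mul_of_nonneg_left (hf _ (sub_le_self t d.2)) (norm_nonneg _)

end ExpPoly

section DelayMatrix

variable {ι : Type*} [Fintype ι] [DecidableEq ι]

/-- The matrix `M diag(e^{-s τ₁}, …, e^{-s τₙ})` of exponential polynomials. -/
def delayMatrix (M : Matrix ι ι ℂ) (τ : ι → ℝ≥0) : Matrix ι ι ExpPoly :=
  Matrix.of fun p q => AddMonoidAlgebra.single (τ q) (M p q)

lemma eval_delayMatrix_pow_apply (M : Matrix ι ι ℂ) (τ : ι → ℝ≥0) (s : ℂ) (k : ℕ) (p q : ι) :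
    ExpPoly.eval s ((delayMatrix M τ ^ k) p q) =
      ((M * Matrix.diagonal fun i => Complex.exp (-s * (τ i : ℝ))) ^ k) p q := by
  have h : (ExpPoly.eval s).mapMatrix (delayMatrix M τ) =
      M * Matrix.diagonal fun i => Complex.exp (-s * (τ i : ℝ)) := by
    ext i j
    simp [delayMatrix]
  rw [← h, ← map_pow, AlgHom.mapMatrix_apply, Matrix.map_apply]

lemma summable_norm_delayMatrix_pow {𝕜 : Type*} [RCLike 𝕜] {n : ℕ}
    {M : Matrix (Fin n) (Fin n) 𝕜} (τ : Fin n → ℝ≥0)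
    (hM : normInftyInfty M < 1 ∨ (Summable fun k : ℕ => absMatrix M ^ k) ∨
      ∃ k₀ : ℕ, 0 < k₀ ∧ ∀ p, ∑ r, ‖(delayMatrix (complexify M) τ ^ k₀) p r‖ < 1)
    (p q : Fin n) :
    Summable fun k : ℕ => ‖(delayMatrix (complexify M) τ ^ k) p q‖ := by
  have hnorm (p q) : ‖delayMatrix (complexify M) τ p q‖ = ‖M p q‖ := by
    simp only [delayMatrix, Matrix.of_apply, ExpPoly.norm_single, norm_complexify_apply]
  rcases hM with hM | hM | ⟨k₀, hk₀, hM⟩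
  · refine summable_norm_matrix_pow_apply one_pos (fun p => ?_) p q
    simpa only [pow_one, hnorm] using (sum_norm_row_le_normInftyInfty M p).trans_lt hM
  · have hmap : (delayMatrix (complexify M) τ).map (‖·‖) = M.map (‖·‖) := by
      ext p q
      exact hnorm p q
    refine .of_nonneg_of_le (fun _ => norm_nonneg _) (fun k => ?_)
      ((summable_absMatrix_pow_iff M).mp hM p q)
    exact hmap ▸ norm_matrix_pow_apply_le (delayMatrix (complexify M) τ) k p q
  · exact summable_norm_matrix_pow_apply hk₀ hM p q

end DelayMatrix

/-! ### The total variation of the inverse Laplace transform of an exponential polynomial -/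

section LaplaceVariation

lemma norm_exp_neg_mul_le_one {s : ℂ} (hs : 0 ≤ s.re) (t : ℝ≥0) :
    ‖Complex.exp (-s * (t : ℝ))‖ ≤ 1 := by
  rw [Complex.norm_exp, Real.exp_le_one_iff]
  simpa using mul_nonneg hs t.2

lemma integrable_exp_neg_mul (μ : ComplexMeasure ℝ≥0) [IsFiniteMeasure μ.variation] {s : ℂ}
    (hs : 0 ≤ s.re) : μ.Integrable fun t : ℝ≥0 => Complex.exp (-s * (t : ℝ)) :=
  .of_bound (by fun_prop) 1 (ae_of_all _ (norm_exp_neg_mul_le_one hs))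

lemma complexMeasure_integral_const_mul {X : Type*} [MeasurableSpace X] (μ : ComplexMeasure X)
    (c : ℂ) (f : X → ℂ) :
    ∫ᵛ t, c * f t ∂[.mul ℝ ℂ; μ] = c * ∫ᵛ t, f t ∂[.mul ℝ ℂ; μ] := by
  rw [VectorMeasure.integral_eq_setToFun, VectorMeasure.integral_eq_setToFun]
  refine setToFun_smul (𝕜 := ℂ) _ (fun c s x => ?_) c f
  simp [VectorMeasure.transpose, mul_left_comm]

lemma norm_complexMeasure_integral_le {X : Type*} [MeasurableSpace X] (μ : ComplexMeasure X)
    [IsFiniteMeasure μ.variation] {f : X → ℂ} {C : ℝ} (hC : ∀ t, ‖f t‖ ≤ C) :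
    ‖∫ᵛ t, f t ∂[.mul ℝ ℂ; μ]‖ ≤ C * μ.variation.real univ := by
  simpa using VectorMeasure.norm_integral_le_of_norm_le_const (B := .mul ℝ ℂ) (ae_of_all _ hC)

lemma exists_polynomial_norm_sub_le {f : ℝ → ℂ} (hf : Continuous f) (a b : ℝ) {ε : ℝ}
    (hε : 0 < ε) :
    ∃ P : Polynomial ℂ, ∀ x ∈ Icc a b, ‖P.eval (x : ℂ) - f x‖ ≤ ε := by
  obtain ⟨p, hp⟩ := exists_polynomial_near_of_continuousOn a b (fun x => (f x).re)
    (by fun_prop) (ε / 2) (half_pos hε)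
  obtain ⟨q, hq⟩ := exists_polynomial_near_of_continuousOn a b (fun x => (f x).im)
    (by fun_prop) (ε / 2) (half_pos hε)
  refine ⟨p.map Complex.ofRealHom + .C Complex.I * q.map Complex.ofRealHom, fun x hx => ?_⟩
  have h (r : Polynomial ℝ) : (r.map Complex.ofRealHom).eval (x : ℂ) = (r.eval x : ℝ) :=
    Polynomial.eval_map_apply Complex.ofRealHom x
  refine (Complex.norm_le_abs_re_add_abs_im _).trans ?_
  simp only [Polynomial.eval_add, Polynomial.eval_mul, Polynomial.eval_C, h, Complex.sub_re,
    Complex.add_re, Complex.sub_im, Complex.add_im]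
  simp
  linarith [hp x hx, hq x hx]

variable {μ : ComplexMeasure ℝ≥0}

lemma integral_exp_mul_polynomial_eq_zero [IsFiniteMeasure μ.variation] {N : ℕ}
    (h : ∀ k ≥ N, ∫ᵛ t, Complex.exp (-(k : ℂ) * (t : ℝ)) ∂[.mul ℝ ℂ; μ] = 0) (P : Polynomial ℂ) :
    ∫ᵛ t, Complex.exp (-(N : ℂ) * (t : ℝ)) * P.eval (Real.exp (-t) : ℂ) ∂[.mul ℝ ℂ; μ] = 0 := by
  have hexp (t : ℝ≥0) : Complex.exp (-(N : ℂ) * (t : ℝ)) * P.eval (Real.exp (-t) : ℂ) =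
      ∑ k ∈ P.support, P.coeff k * Complex.exp (-((N + k : ℕ) : ℂ) * (t : ℝ)) := by
    rw [Polynomial.eval_eq_sum, Polynomial.sum, Finset.mul_sum]
    refine Finset.sum_congr rfl fun k _ => ?_
    rw [Complex.ofReal_exp, ← Complex.exp_nat_mul, mul_left_comm, ← Complex.exp_add]
    congr 2
    push_cast
    ring
  simp_rw [hexp]
  rw [VectorMeasure.integral_finsetSum]
  · refine Finset.sum_eq_zero fun k _ => ?_
    rw [complexMeasure_integral_const_mul, h _ (Nat.le_add_right N k), mul_zero]
  · intro k _
    have hre : 0 ≤ ((N + k : ℕ) : ℂ).re := by simp only [Complex.natCast_re, Nat.cast_nonneg]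
    exact (integrable_exp_neg_mul μ hre).smul (P.coeff k)

lemma integral_exp_mul_comp_exp_eq_zero [IsFiniteMeasure μ.variation] {N : ℕ}
    (h : ∀ k ≥ N, ∫ᵛ t, Complex.exp (-(k : ℂ) * (t : ℝ)) ∂[.mul ℝ ℂ; μ] = 0)
    {f : ℝ → ℂ} (hf : Continuous f) :
    ∫ᵛ t, Complex.exp (-(N : ℂ) * (t : ℝ)) * f (Real.exp (-t)) ∂[.mul ℝ ℂ; μ] = 0 := by
  have hexp_mem (t : ℝ≥0) : Real.exp (-t) ∈ Icc (0 : ℝ) 1 :=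
    ⟨(Real.exp_pos _).le, Real.exp_le_one_iff.mpr (neg_nonpos.mpr t.2)⟩
  have hexp_le (t : ℝ≥0) : ‖Complex.exp (-(N : ℂ) * (t : ℝ))‖ ≤ 1 :=
    norm_exp_neg_mul_le_one (by simp) t
  have hint {g : ℝ → ℂ} (hg : Continuous g) :
      μ.Integrable fun t : ℝ≥0 => Complex.exp (-(N : ℂ) * (t : ℝ)) * g (Real.exp (-t)) := by
    obtain ⟨C, hC⟩ := isCompact_Icc.exists_bound_of_continuousOn hg.continuousOn
    refine .of_bound (by fun_prop) C (ae_of_all _ fun t => (norm_mul_le _ _).trans ?_)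
    simpa using mul_le_mul (hexp_le t) (hC _ (hexp_mem t)) (norm_nonneg _) zero_le_one
  set V : ℝ := μ.variation.real univ
  rw [← norm_le_zero_iff]
  refine le_of_forall_pos_le_add fun ε hε => ?_
  have hV : 0 < V + 1 := by positivity
  obtain ⟨P, hP⟩ := exists_polynomial_norm_sub_le hf 0 1 (div_pos hε hV)
  calc ‖∫ᵛ t, Complex.exp (-(N : ℂ) * (t : ℝ)) * f (Real.exp (-t)) ∂[.mul ℝ ℂ; μ]‖
      = ‖∫ᵛ t, (Complex.exp (-(N : ℂ) * (t : ℝ)) * P.eval (Real.exp (-t) : ℂ) -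
          Complex.exp (-(N : ℂ) * (t : ℝ)) * f (Real.exp (-t))) ∂[.mul ℝ ℂ; μ]‖ := by
        rw [VectorMeasure.integral_fun_sub
          (hint (g := fun x => P.eval (x : ℂ)) (by fun_prop)) (hint hf),
          integral_exp_mul_polynomial_eq_zero h, zero_sub, norm_neg]
    _ ≤ ε / (V + 1) * V := by
        refine norm_complexMeasure_integral_le μ fun t => ?_
        rw [← mul_sub, norm_mul]
        simpa using mul_le_mul (hexp_le t) (hP _ (hexp_mem t)) (norm_nonneg _) zero_le_one
    _ ≤ 0 + ε := by
        rw [zero_add, div_mul_eq_mul_div, div_le_iff₀ hV]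
        gcongr
        linarith

lemma exists_continuous_eq_on_finset {X : Type*} [TopologicalSpace X] [NormalSpace X] [T1Space X]
    (F : Finset X) {w : X → ℂ} (hw : ∀ x, ‖w x‖ ≤ 1) :
    ∃ g : X → ℂ, Continuous g ∧ (∀ x, ‖g x‖ ≤ 1) ∧ ∀ x ∈ F, g x = w x := by
  have := Metric.instTietzeExtensionClosedBall ℂ (0 : ℂ) one_pos
  let w' : C((F : Set X), ℂ) := ⟨fun x => w x, continuous_of_discreteTopology⟩
  obtain ⟨g, hg_mem, hg⟩ := w'.exists_forall_mem_restrict_eq F.finite_toSet.isClosed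
    (t := Metric.closedBall 0 1) fun x => by simpa [w'] using hw x
  exact ⟨g, g.continuous, fun x => by simpa using hg_mem x,
    fun x hx => DFunLike.congr_fun hg ⟨x, hx⟩⟩

lemma exists_continuous_exp_mul_comp_exp_eq_on_finset (F : Finset ℝ≥0) {w : ℝ≥0 → ℂ}
    (hw : ∀ d, ‖w d‖ ≤ 1) (N : ℕ) :
    ∃ f : ℝ → ℂ, Continuous f ∧
      (∀ t : ℝ≥0, ‖Complex.exp (-(N : ℂ) * (t : ℝ)) * f (Real.exp (-t))‖ ≤ 1) ∧
      ∀ d ∈ F, Complex.exp (-(N : ℂ) * (d : ℝ)) * f (Real.exp (-d)) = w d := by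
  set δ : ℝ := Real.exp (-(F.sup id : ℝ≥0))
  obtain ⟨g, hg, hg_le, hgw⟩ := exists_continuous_eq_on_finset
    (F.image fun d : ℝ≥0 => Real.exp (-d)) (w := fun x => w (-Real.log x).toNNReal) fun x => hw _
  have hmax (x : ℝ) : 0 < max x δ := (Real.exp_pos _).trans_le (le_max_right x δ)
  have hexp (t : ℝ≥0) : Complex.exp (-(N : ℂ) * (t : ℝ)) = (Real.exp (-t) : ℂ) ^ N := by
    rw [Complex.ofReal_exp, ← Complex.exp_nat_mul]
    push_cast
    ring_nf
  refine ⟨fun x => g x / (max x δ : ℝ) ^ N, ?_, fun t => ?_, fun d hd => ?_⟩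
  · exact hg.div (by fun_prop) fun x => pow_ne_zero N (mod_cast (hmax x).ne')
  · rw [hexp, mul_div_left_comm, ← div_pow, norm_mul, norm_pow, ← Complex.ofReal_div,
      Complex.norm_of_nonneg (div_nonneg (Real.exp_pos _).le (hmax _).le)]
    exact mul_le_one₀ (hg_le _) (by positivity)
      (pow_le_one₀ (by positivity) (div_le_one_of_le₀ (le_max_left _ _) (hmax _).le))
  · have hdδ : max (Real.exp (-d)) δ = Real.exp (-d) :=
      max_eq_left (Real.exp_le_exp.mpr (neg_le_neg (mod_cast Finset.le_sup (f := id) hd)))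
    have hgd : g (Real.exp (-d)) = w d := by
      simpa using hgw _ (Finset.mem_image_of_mem _ hd)
    simp only [hexp, hdδ, hgd]
    rw [mul_div_cancel₀ _ (pow_ne_zero N (mod_cast (Real.exp_pos _).ne'))]

namespace ExpPoly

/-- The measure `∑ c_d δ_d` with Laplace transform `∑ c_d e^{-sd}`. -/
def toMeasure (a : ExpPoly) : ComplexMeasure ℝ≥0 :=
  ∑ d ∈ a.coeff.support, VectorMeasure.dirac d (a.coeff d)

lemma variation_toMeasure_le (a : ExpPoly) :
    a.toMeasure.variation univ ≤ ENNReal.ofReal ‖a‖ := by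
  rw [norm_def, ENNReal.ofReal_sum_of_nonneg fun _ _ => norm_nonneg _]
  refine (VectorMeasure.variation_finsetSum_le _ _ univ).trans_eq ?_
  simp [Measure.finsetSum_apply, VectorMeasure.variation_dirac, ofReal_norm]

instance (a : ExpPoly) : IsFiniteMeasure a.toMeasure.variation :=
  ⟨a.variation_toMeasure_le.trans_lt ENNReal.ofReal_lt_top⟩

lemma integral_toMeasure (a : ExpPoly) (f : ℝ≥0 → ℂ) :
    ∫ᵛ t, f t ∂[.mul ℝ ℂ; a.toMeasure] = ∑ d ∈ a.coeff.support, a.coeff d * f d := by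
  rw [toMeasure, VectorMeasure.integral_finsetSum_vectorMeasure]
  · refine Finset.sum_congr rfl fun d _ => ?_
    rw [VectorMeasure.integral_dirac, ContinuousLinearMap.mul_apply', mul_comm]
  · intro d _
    rw [VectorMeasure.Integrable, VectorMeasure.variation_dirac]
    exact (integrable_dirac (by simp)).smul_measure (by simp)

lemma isInverseLaplace_toMeasure (a : ExpPoly) :
    IsInverseLaplace a.toMeasure fun s => eval s a :=
  ⟨measure_ne_top _ _, 0, le_rfl, fun s _ =>
    (integral_toMeasure a _).trans (eval_apply s a).symm⟩

lemma norm_le_variation (a : ExpPoly) {μ : ComplexMeasure ℝ≥0}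
    (hμ : IsInverseLaplace μ fun s => eval s a) :
    ENNReal.ofReal ‖a‖ ≤ μ.variation univ := by
  obtain ⟨hfin, α, -, hL⟩ := hμ
  have : IsFiniteMeasure μ.variation := ⟨lt_top_iff_ne_top.mpr hfin⟩
  have : IsFiniteMeasure (μ - a.toMeasure).variation :=
    ⟨(VectorMeasure.variation_sub_le univ).trans_lt
      (ENNReal.add_lt_top.mpr ⟨measure_lt_top _ _, measure_lt_top _ _⟩)⟩
  obtain ⟨N, hN⟩ := exists_nat_gt α
  have hN_nonneg {k : ℕ} : 0 ≤ ((k : ℂ)).re := by simp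
  have hzero : ∀ k ≥ N, ∫ᵛ t, Complex.exp (-(k : ℂ) * (t : ℝ))
      ∂[.mul ℝ ℂ; μ - a.toMeasure] = 0 := fun k hk => by
    rw [VectorMeasure.integral_sub_vectorMeasure (integrable_exp_neg_mul μ hN_nonneg)
      (integrable_exp_neg_mul _ hN_nonneg), integral_toMeasure a,
      hL k (by simpa using hN.trans_le (mod_cast hk))]
    exact sub_eq_zero.mpr (eval_apply _ a)
  choose w hw hcw using fun d => RCLike.exists_norm_eq_mul_self (a.coeff d)
  obtain ⟨f, hf, hf_le, hfw⟩ :=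
    exists_continuous_exp_mul_comp_exp_eq_on_finset a.coeff.support
      (fun d => (hw d).le) N
  have hint (ν : ComplexMeasure ℝ≥0) [IsFiniteMeasure ν.variation] :
      ν.Integrable fun t : ℝ≥0 => Complex.exp (-(N : ℂ) * (t : ℝ)) * f (Real.exp (-t)) :=
    .of_bound (by fun_prop) 1 (ae_of_all _ hf_le)
  have hpair : ∫ᵛ t, Complex.exp (-(N : ℂ) * (t : ℝ)) * f (Real.exp (-t)) ∂[.mul ℝ ℂ; μ] =
      (‖a‖ : ℂ) := by
    have h := integral_exp_mul_comp_exp_eq_zero hzero hf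
    rw [VectorMeasure.integral_sub_vectorMeasure (hint μ) (hint _), sub_eq_zero,
      integral_toMeasure a] at h
    rw [h, norm_def, Complex.ofReal_sum]
    exact Finset.sum_congr rfl fun d hd => by rw [hfw d hd, mul_comm]; exact (hcw d).symm
  rw [ENNReal.ofReal_le_iff_le_toReal hfin]
  have h := norm_complexMeasure_integral_le μ hf_le
  rwa [hpair, one_mul, Complex.norm_of_nonneg (norm_nonneg a)] at h

theorem laplaceVariation_eval (a : ExpPoly) :
    laplaceVariation (fun s => eval s a) = ENNReal.ofReal ‖a‖ :=
  le_antisymm ((iInf₂_le a.toMeasure a.isInverseLaplace_toMeasure).trans a.variation_toMeasure_le)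
    (le_iInf₂ fun _ => a.norm_le_variation)

end ExpPoly

end LaplaceVariation

/-! ### Diagonal matrices -/

section Diagonal

variable {ι : Type*} [Fintype ι] [DecidableEq ι]

lemma inv_diagonal_of_ne_zero {K : Type*} [Field K] {d : ι → K} (hd : ∀ i, d i ≠ 0) :
    (Matrix.diagonal d)⁻¹ = Matrix.diagonal d⁻¹ := by
  refine Matrix.inv_eq_right_inv ?_
  rw [Matrix.diagonal_mul_diagonal, ← Matrix.diagonal_one]
  exact congrArg Matrix.diagonal (funext fun i => mul_inv_cancel₀ (hd i))

lemma spectrum_diagonal_ofReal_subset {𝕜 : Type*} [RCLike 𝕜] (d : ι → ℝ) :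
    spectrum ℝ (Matrix.diagonal fun i => (d i : 𝕜)) ⊆ range d := by
  refine (AlgHom.spectrum_apply_subset (Matrix.diagonalAlgHom ℝ) fun i => (d i : 𝕜)).trans ?_
  rw [Pi.spectrum_eq]
  refine iUnion_subset fun i => ?_
  rw [← RCLike.algebraMap_eq_ofReal, spectrum.scalar_eq, singleton_subset_iff]
  exact mem_range_self i

lemma cfc_diagonal_ofReal {𝕜 : Type*} [RCLike 𝕜] (f : ℝ → ℝ) (d : ι → ℝ) :
    cfc f (Matrix.diagonal fun i => (d i : 𝕜)) = Matrix.diagonal fun i => (f (d i) : 𝕜) := by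
  have hsa : IsSelfAdjoint (Matrix.diagonal fun i => (d i : 𝕜)) :=
    Matrix.isHermitian_diagonal_of_self_adjoint _ (funext fun i => RCLike.conj_ofReal (d i))
  set P := Lagrange.interpolate (Finset.univ.image d) id f
  have hP (i : ι) : P.eval (d i) = f (d i) :=
    Lagrange.eval_interpolate_at_node f (injOn_id _) (Finset.mem_image_of_mem d (Finset.mem_univ i))
  have hspec : EqOn f P.eval (spectrum ℝ (Matrix.diagonal fun i => (d i : 𝕜))) := by
    intro x hx
    obtain ⟨i, rfl⟩ := spectrum_diagonal_ofReal_subset d hx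
    exact (hP i).symm
  rw [cfc_congr hspec, cfc_polynomial P _ hsa]
  refine (Polynomial.aeval_algHom_apply (Matrix.diagonalAlgHom ℝ) (fun i => (d i : 𝕜)) P).trans ?_
  refine congrArg Matrix.diagonal (funext fun i => ?_)
  rw [Polynomial.aeval_pi]
  exact (Polynomial.aeval_algebraMap_apply 𝕜 (d i) P).trans <| by
    rw [Polynomial.coe_aeval_eq_eval, hP, RCLike.algebraMap_eq_ofReal]

end Diagonal

/-! ### The diagonalised system in the frequency domain -/

section Volterra

lemma continuous_exp_integral {κ : ℝ → ℂ} (hκ : Continuous κ) (a : ℝ) :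
    Continuous fun ζ => Complex.exp (∫ τ in a..ζ, κ τ) :=
  Complex.continuous_exp.comp
    (intervalIntegral.continuous_primitive (fun _ _ => hκ.intervalIntegrable _ _) a)

lemma hasDerivAt_exp_integral {κ : ℝ → ℂ} (hκ : Continuous κ) (a ζ : ℝ) :
    HasDerivAt (fun ζ => Complex.exp (∫ τ in a..ζ, κ τ))
      (κ ζ * Complex.exp (∫ τ in a..ζ, κ τ)) ζ := by
  simpa only [mul_comm] using (hκ.integral_hasStrictDerivAt a ζ).hasDerivAt.cexp

lemma exp_integral_eq_one_add_integral {κ : ℝ → ℂ} (hκ : Continuous κ) (a ζ : ℝ) :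
    Complex.exp (∫ τ in a..ζ, κ τ) =
      1 + ∫ τ in a..ζ, κ τ * Complex.exp (∫ σ in a..τ, κ σ) := by
  rw [intervalIntegral.integral_eq_sub_of_hasDerivAt (fun x _ => hasDerivAt_exp_integral hκ a x)
    ((hκ.mul (continuous_exp_integral hκ a)).intervalIntegrable _ _)]
  simp

lemma eq_mul_exp_integral_of_volterra {a b : ℝ} (hab : a ≤ b) {κ f : ℝ → ℂ} {c : ℂ}
    (hκ : Continuous κ) (hf : ContinuousOn f (Icc a b))
    (h : ∀ ζ ∈ Icc a b, f ζ = c + ∫ τ in a..ζ, κ τ * f τ) :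
    f b = c * Complex.exp (∫ τ in a..b, κ τ) := by
  set g : ℝ → ℂ := IccExtend hab ((Icc a b).domRestrict f)
  have hg : Continuous g := hf.domRestrict.Icc_extend'
  have hgf {ζ : ℝ} (hζ : ζ ∈ Icc a b) : g ζ = f ζ := IccExtend_of_mem hab _ hζ
  set F : ℝ → ℂ := fun ζ => c + ∫ τ in a..ζ, κ τ * g τ
  have hF (ζ : ℝ) : HasDerivAt F (κ ζ * g ζ) ζ :=
    ((hκ.mul hg).integral_hasStrictDerivAt a ζ).hasDerivAt.const_add c
  have hFf {ζ : ℝ} (hζ : ζ ∈ Icc a b) : F ζ = f ζ := by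
    rw [h ζ hζ]
    refine congrArg (c + ·) (intervalIntegral.integral_congr fun τ hτ => ?_)
    rw [uIcc_of_le hζ.1] at hτ
    exact congrArg (κ τ * ·) (hgf ⟨hτ.1, hτ.2.trans hζ.2⟩)
  have hderiv {ζ : ℝ} (hζ : ζ ∈ Icc a b) :
      HasDerivAt (fun ζ => F ζ * Complex.exp (∫ τ in a..ζ, -κ τ)) 0 ζ := by
    refine ((hF ζ).mul (hasDerivAt_exp_integral hκ.neg a ζ)).congr_deriv ?_
    rw [hFf hζ, hgf hζ, Pi.neg_apply]
    ring
  have hconst := constant_of_has_deriv_right_zero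
    (fun ζ hζ => (hderiv hζ).continuousAt.continuousWithinAt)
    (fun ζ hζ => (hderiv (Ico_subset_Icc_self hζ)).hasDerivWithinAt) b ⟨hab, le_rfl⟩
  simp only [F, intervalIntegral.integral_same, add_zero, Complex.exp_zero, mul_one,
    intervalIntegral.integral_neg, Complex.exp_neg] at hconst
  rw [← hFf ⟨hab, le_rfl⟩]
  exact (mul_inv_eq_iff_eq_mul₀ (Complex.exp_ne_zero _)).mp hconst

end Volterra

lemma complexify_diagonal_ofReal {𝕜 : Type*} [RCLike 𝕜] {n : ℕ} (d : Fin n → ℝ) :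
    complexify (Matrix.diagonal fun i => (d i : 𝕜)) = Matrix.diagonal fun i => (d i : ℂ) := by
  rw [complexify, Matrix.diagonal_map (map_zero _)]
  simp

namespace HBCS

lemma P1D_mul_self {𝕜 : Type*} [RCLike 𝕜] {n : ℕ} (m : ℕ) : P1D 𝕜 n m * P1D 𝕜 n m = 1 := by
  rw [P1D, Matrix.diagonal_mul_diagonal, ← Matrix.diagonal_one]
  congr 1
  ext i
  split_ifs <;> simp

namespace Diagonalisation

variable {𝕜 : Type*} [RCLike 𝕜] {n : ℕ} {sys : HBCS 𝕜 n} (D : sys.Diagonalisation)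

/-- The sign of the `i`-th diagonal entry of `P₁^D`. -/
def sgn (i : Fin n) : ℝ := if (i : ℕ) < D.m then 1 else -1

lemma sgn_mul_self (i : Fin n) : D.sgn i * D.sgn i = 1 := by
  unfold sgn
  split_ifs <;> norm_num

lemma sgn_ne_zero (i : Fin n) : D.sgn i ≠ 0 := left_ne_zero_of_mul_eq_one (D.sgn_mul_self i)

lemma P1D_eq_diagonal_sgn : P1D 𝕜 n D.m = Matrix.diagonal fun i => (D.sgn i : 𝕜) := by
  rw [P1D]
  congr 1
  ext i
  unfold sgn
  split_ifs <;> simp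

lemma system_Qplus :
    D.system.Qplus = Matrix.diagonal fun i : Fin n => if (i : ℕ) < D.m then (1 : 𝕜) else 0 := by
  simp only [Qplus, system, P1D_eq_diagonal_sgn, cfc_diagonal_ofReal]
  congr 1
  ext i
  unfold sgn
  split_ifs <;> simp [Real.sqrt_eq_zero_of_nonpos]

lemma system_Qminus :
    D.system.Qminus = Matrix.diagonal fun i : Fin n => if (i : ℕ) < D.m then (0 : 𝕜) else 1 := by
  simp only [Qminus, system, P1D_eq_diagonal_sgn, cfc_diagonal_ofReal]
  congr 1
  ext i
  unfold sgn
  split_ifs <;> simp [Real.sqrt_eq_zero_of_nonpos]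

/-- The reciprocal propagation speed `1 / hᵢ`, extended continuously from `[a, b]` to `ℝ`. -/
def slowness (i : Fin n) : ℝ → ℝ :=
  IccExtend sys.hab.le ((Icc sys.a sys.b).domRestrict fun ξ => (D.h ξ i)⁻¹)

lemma slowness_eq (i : Fin n) {ξ : ℝ} (hξ : ξ ∈ Icc sys.a sys.b) :
    D.slowness i ξ = (D.h ξ i)⁻¹ :=
  IccExtend_of_mem _ _ hξ

lemma slowness_pos (i : Fin n) (ξ : ℝ) : 0 < D.slowness i ξ :=
  inv_pos.mpr (D.h_pos _ (Subtype.coe_prop _) i)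

lemma continuous_slowness (i : Fin n) : Continuous (D.slowness i) :=
  ((D.h_contDiff i).continuousOn.inv₀ fun ξ hξ => (D.h_pos ξ hξ i).ne').domRestrict.Icc_extend'

/-- The time in which the `i`-th component travels through `[a, b]`. -/
def travelTime (i : Fin n) : ℝ := ∫ ζ in sys.a..sys.b, D.slowness i ζ

lemma travelTime_pos (i : Fin n) : 0 < D.travelTime i :=
  intervalIntegral.intervalIntegral_pos_of_pos ((D.continuous_slowness i).intervalIntegrable _ _)
    (D.slowness_pos i) sys.hab

/-- The travel times as nonnegative numbers, the exponents of the entries of `U(s)`. -/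
def delays (i : Fin n) : ℝ≥0 := ⟨D.travelTime i, (D.travelTime_pos i).le⟩

@[simp] lemma coe_delays (i : Fin n) : (D.delays i : ℝ) = D.travelTime i := rfl

lemma fundamentalSolution_integrand_eq {ξ : ℝ} (hξ : ξ ∈ Icc sys.a sys.b) (h0 : D.P0D ξ = 0)
    (s : ℂ) (A : Matrix (Fin n) (Fin n) ℂ) (i j : Fin n) :
    (-(complexify D.system.P1)⁻¹ * (complexify (D.system.P0 ξ) -
        s • (complexify (D.system.H ξ))⁻¹) * A) i j =
      s * D.sgn i * D.slowness i ξ * A i j := by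
  have hP1 : (complexify D.system.P1)⁻¹ = Matrix.diagonal fun i => (D.sgn i : ℂ) := by
    simp only [system, P1D_eq_diagonal_sgn, complexify_diagonal_ofReal]
    rw [inv_diagonal_of_ne_zero fun i => mod_cast D.sgn_ne_zero i]
    refine congrArg Matrix.diagonal (funext fun i => inv_eq_of_mul_eq_one_left ?_)
    rw [← Complex.ofReal_mul, D.sgn_mul_self, Complex.ofReal_one]
  have hH : (complexify (D.system.H ξ))⁻¹ = Matrix.diagonal fun i => (D.slowness i ξ : ℂ) := by
    simp only [system, complexify_diagonal_ofReal, D.slowness_eq _ hξ]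
    rw [inv_diagonal_of_ne_zero fun i => mod_cast (D.h_pos ξ hξ i).ne']
    exact congrArg Matrix.diagonal (funext fun i => (Complex.ofReal_inv _).symm)
  have hP0 : complexify (D.system.P0 ξ) = 0 := by
    simp only [system, h0, complexify]
    exact Matrix.map_zero _ (map_zero _)
  rw [hP1, hH, hP0, zero_sub, neg_mul_neg, ← Matrix.diagonal_smul, Matrix.diagonal_mul_diagonal,
    Matrix.diagonal_mul]
  simp only [Pi.smul_apply, smul_eq_mul]
  ring

lemma isFundamentalSolution_iff (hP0 : ∀ᵐ ξ ∂sys.vol, D.P0D ξ = 0)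
    (s : ℂ) (Ψ : ℝ → Matrix (Fin n) (Fin n) ℂ) :
    D.system.IsFundamentalSolution s Ψ ↔ ContinuousOn Ψ (Icc sys.a sys.b) ∧
      ∀ ζ ∈ Icc sys.a sys.b, ∀ i j, Ψ ζ i j = (1 : Matrix (Fin n) (Fin n) ℂ) i j +
        ∫ τ in sys.a..ζ, s * D.sgn i * D.slowness i τ * Ψ τ i j := by
  refine and_congr Iff.rfl (forall₂_congr fun ζ hζ => forall₂_congr fun i j => ?_)
  have hint : ∫ τ in sys.a..ζ, (-(complexify D.system.P1)⁻¹ * (complexify (D.system.P0 τ) -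
        s • (complexify (D.system.H τ))⁻¹) * Ψ τ) i j =
      ∫ τ in sys.a..ζ, s * D.sgn i * D.slowness i τ * Ψ τ i j := by
    refine intervalIntegral.integral_congr_ae ?_
    rw [ae_restrict_iff' measurableSet_Icc] at hP0
    filter_upwards [hP0] with τ hP0τ hτ
    rw [uIoc_of_le (show sys.a ≤ ζ from hζ.1)] at hτ
    have hτ' : τ ∈ Icc sys.a sys.b := ⟨hτ.1.le, hτ.2.trans hζ.2⟩
    exact D.fundamentalSolution_integrand_eq hτ' (hP0τ hτ') s _ i j
  exact hint ▸ Iff.rfl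

lemma continuous_sgn_mul_slowness (s : ℂ) (i : Fin n) :
    Continuous fun τ => s * D.sgn i * D.slowness i τ :=
  continuous_const.mul (Complex.continuous_ofReal.comp (D.continuous_slowness i))

lemma isFundamentalSolution_diagonal_exp (hP0 : ∀ᵐ ξ ∂sys.vol, D.P0D ξ = 0) (s : ℂ) :
    D.system.IsFundamentalSolution s fun ζ => Matrix.diagonal fun i =>
      Complex.exp (∫ τ in sys.a..ζ, s * D.sgn i * D.slowness i τ) := by
  rw [D.isFundamentalSolution_iff hP0]
  refine ⟨(continuous_pi fun i => continuous_exp_integral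
    (D.continuous_sgn_mul_slowness s i) _).matrix_diagonal.continuousOn, fun ζ _ i j => ?_⟩
  rcases eq_or_ne i j with rfl | hij
  · simpa only [Matrix.diagonal_apply_eq, Matrix.one_apply_eq] using
      exp_integral_eq_one_add_integral (D.continuous_sgn_mul_slowness s i) sys.a ζ
  · simp [hij]

lemma fundamentalSolution_system_apply (hP0 : ∀ᵐ ξ ∂sys.vol, D.P0D ξ = 0) (s : ℂ) :
    D.system.fundamentalSolution s sys.b =
      Matrix.diagonal fun i => Complex.exp (s * D.sgn i * D.travelTime i) := by
  have hΨ : D.system.IsFundamentalSolution s (D.system.fundamentalSolution s) :=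
    Classical.epsilon_spec ⟨_, D.isFundamentalSolution_diagonal_exp hP0 s⟩
  obtain ⟨hcont, hvolterra⟩ := (D.isFundamentalSolution_iff hP0 s _).mp hΨ
  ext i j
  rw [eq_mul_exp_integral_of_volterra (f := fun ζ => D.system.fundamentalSolution s ζ i j)
    sys.hab.le (D.continuous_sgn_mul_slowness s i)
    ((continuous_apply_apply i j).comp_continuousOn hcont) (fun ζ hζ => hvolterra ζ hζ i j),
    intervalIntegral.integral_const_mul, intervalIntegral.integral_ofReal, ← travelTime]
  rcases eq_or_ne i j with rfl | hij <;> simp [*]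

lemma complexify_system_Qplus : complexify D.system.Qplus =
    Matrix.diagonal fun i : Fin n => if (i : ℕ) < D.m then (1 : ℂ) else 0 := by
  rw [D.system_Qplus, complexify, Matrix.diagonal_map (map_zero _)]
  simp [apply_ite (RCLike.map 𝕜 ℂ)]

lemma complexify_system_Qminus : complexify D.system.Qminus =
    Matrix.diagonal fun i : Fin n => if (i : ℕ) < D.m then (0 : ℂ) else 1 := by
  rw [D.system_Qminus, complexify, Matrix.diagonal_map (map_zero _)]
  simp [apply_ite (RCLike.map 𝕜 ℂ)]

lemma system_U (hP0 : ∀ᵐ ξ ∂sys.vol, D.P0D ξ = 0) (s : ℂ) :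
    D.system.U s = Matrix.diagonal fun i => Complex.exp (-s * (D.delays i : ℝ)) := by
  have hΨ : D.system.fundamentalSolution s D.system.b = _ :=
    D.fundamentalSolution_system_apply hP0 s
  have hV : D.system.V s = Matrix.diagonal fun i : Fin n =>
      if (i : ℕ) < D.m then Complex.exp (s * D.travelTime i) else 1 := by
    rw [V, hΨ, D.complexify_system_Qplus, D.complexify_system_Qminus,
      Matrix.diagonal_mul_diagonal, Matrix.diagonal_add]
    congr 1
    ext i
    by_cases hi : (i : ℕ) < D.m <;> simp [hi, sgn]
  have hV_ne (i : Fin n) :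
      (if (i : ℕ) < D.m then Complex.exp (s * D.travelTime i) else 1) ≠ 0 := by
    split_ifs
    exacts [Complex.exp_ne_zero _, one_ne_zero]
  rw [U, hV, hΨ, inv_diagonal_of_ne_zero hV_ne, D.complexify_system_Qplus,
    D.complexify_system_Qminus, Matrix.diagonal_mul_diagonal, Matrix.diagonal_add,
    Matrix.diagonal_mul_diagonal]
  congr 1
  ext i
  by_cases hi : (i : ℕ) < D.m <;> simp [hi, sgn, Complex.exp_neg]

theorem powVariation_system (hP0 : ∀ᵐ ξ ∂sys.vol, D.P0D ξ = 0)
    (M : Matrix (Fin n) (Fin n) 𝕜) (k : ℕ) (p q : Fin n) :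
    D.system.powVariation M k p q =
      ENNReal.ofReal ‖(delayMatrix (complexify M) D.delays ^ k) p q‖ := by
  rw [powVariation, ← ExpPoly.laplaceVariation_eval]
  refine congrArg laplaceVariation (funext fun s => ?_)
  rw [eval_delayMatrix_pow_apply, D.system_U hP0]

lemma summable_norm_delayMatrix_delays_pow (hP0 : ∀ᵐ ξ ∂sys.vol, D.P0D ξ = 0)
    {M : Matrix (Fin n) (Fin n) 𝕜}
    (hM : normInftyInfty M < 1 ∨ (Summable fun k : ℕ => absMatrix M ^ k) ∨
      ∃ k₀ : ℕ, 0 < k₀ ∧ ∀ p, ∑ r, D.system.powVariation M k₀ p r < 1) (p q : Fin n) :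
    Summable fun k : ℕ => ‖(delayMatrix (complexify M) D.delays ^ k) p q‖ := by
  refine summable_norm_delayMatrix_pow D.delays (hM.imp_right (Or.imp_right ?_)) p q
  rintro ⟨k₀, hk₀, hM⟩
  refine ⟨k₀, hk₀, fun p => ?_⟩
  have := hM p
  simp_rw [D.powVariation_system hP0] at this
  rwa [← ENNReal.ofReal_sum_of_nonneg fun _ _ => norm_nonneg _, ENNReal.ofReal_lt_one] at this

end Diagonalisation

end HBCS

/-! ### Strongly continuous semigroups -/

section Semigroup

variable {𝕜 : Type*} [RCLike 𝕜] {X : Type*} [NormedAddCommGroup X] [NormedSpace 𝕜 X]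
  {T : ℝ≥0 → X →L[𝕜] X}

/-- `T` is a strongly continuous one-parameter semigroup. -/
structure IsC0Semigroup (T : ℝ≥0 → X →L[𝕜] X) : Prop where
  map_zero : T 0 = 1
  map_add : ∀ s t, T (s + t) = T s * T t
  continuous_orbit : ∀ x, Continuous fun t => T t x

/-- The graph of the infinitesimal generator of `T`, as a relation. -/
def generatorGraph (T : ℝ≥0 → X →L[𝕜] X) (x y : X) : Prop :=
  Tendsto (fun t : ℝ≥0 => ((t : ℝ) : 𝕜)⁻¹ • (T t x - x)) (𝓝[>] 0) (𝓝 y)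

lemma generatesC0Semigroup_iff {G : X → X → Prop} :
    GeneratesC0Semigroup 𝕜 G ↔
      ∃ T : ℝ≥0 → X →L[𝕜] X, IsC0Semigroup T ∧ ∀ x y, G x y ↔ generatorGraph T x y :=
  ⟨fun ⟨T, h0, hadd, hcont, hG⟩ => ⟨T, ⟨h0, hadd, hcont⟩, hG⟩,
    fun ⟨T, ⟨h0, hadd, hcont⟩, hG⟩ => ⟨T, h0, hadd, hcont, hG⟩⟩

lemma tendsto_coe_nnreal_nhdsGT_zero : Tendsto (fun t : ℝ≥0 => (t : ℝ)) (𝓝[>] 0) (𝓝[>] 0) :=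
  NNReal.continuous_coe.tendsto' 0 0 rfl |>.inf <|
    tendsto_principal_principal.mpr fun t ht => by simpa using ht

lemma tendsto_toNNReal_sub_nhdsGT (t : ℝ) :
    Tendsto (fun s => (s - t).toNNReal) (𝓝[>] t) (𝓝[>] 0) :=
  (continuous_real_toNNReal.comp (continuous_id.sub continuous_const)).tendsto' t 0 (by simp)
    |>.inf <| tendsto_principal_principal.mpr fun s hs => by simpa using hs

namespace IsC0Semigroup

lemma generatorGraph_apply (hT : IsC0Semigroup T) {x z : X} (hxz : generatorGraph T x z)
    (t : ℝ≥0) : generatorGraph T (T t x) (T t z) := by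
  refine (((T t).continuous.tendsto z).comp hxz).congr fun r => ?_
  have hcomm : T r (T t x) = T t (T r x) := by
    rw [← mul_apply_eq_comp, ← mul_apply_eq_comp, ← hT.map_add, ← hT.map_add, add_comm]
  simp only [Function.comp_apply, map_smul, map_sub, hcomm]

lemma continuous_orbit_toNNReal (hT : IsC0Semigroup T) (x : X) :
    Continuous fun s : ℝ => T s.toNNReal x :=
  (hT.continuous_orbit x).comp continuous_real_toNNReal

variable [NormedSpace ℝ X]

lemma apply_integral_orbit [CompleteSpace X] (hT : IsC0Semigroup T) (x : X) {t : ℝ} (ht : 0 ≤ t)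
    (r : ℝ≥0) :
    T r (∫ s in (0 : ℝ)..t, T s.toNNReal x) = ∫ s in (r : ℝ)..t + r, T s.toNNReal x := by
  rw [← ContinuousLinearMap.intervalIntegral_comp_comm _
    ((hT.continuous_orbit_toNNReal x).intervalIntegrable _ _)]
  have hshift : ∫ s in (0 : ℝ)..t, T r (T s.toNNReal x) =
      ∫ s in (0 : ℝ)..t, T (s + r).toNNReal x := by
    refine intervalIntegral.integral_congr fun s hs => ?_
    rw [uIcc_of_le ht] at hs
    rw [Real.toNNReal_add hs.1 r.coe_nonneg, Real.toNNReal_coe, add_comm, hT.map_add,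
      mul_apply_eq_comp]
  rw [hshift, intervalIntegral.integral_comp_add_right (fun s => T s.toNNReal x), zero_add]

variable [IsScalarTower ℝ 𝕜 X]

lemma hasDerivWithinAt_orbit (hT : IsC0Semigroup T) {x z : X} (hxz : generatorGraph T x z)
    {t : ℝ} (ht : 0 ≤ t) :
    HasDerivWithinAt (fun s : ℝ => T s.toNNReal x) (T t.toNNReal z) (Ici t) t := by
  rw [← hasDerivWithinAt_Ioi_iff_Ici, hasDerivWithinAt_iff_tendsto_slope' self_notMem_Ioi]
  refine ((hT.generatorGraph_apply hxz t.toNNReal).comp (tendsto_toNNReal_sub_nhdsGT t)).congr'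
    (eventually_nhdsWithin_of_forall fun s (hs : t < s) => ?_)
  have hsplit : s.toNNReal = (s - t).toNNReal + t.toNNReal := by
    rw [← Real.toNNReal_add (sub_nonneg.mpr hs.le) ht, sub_add_cancel]
  simp only [Function.comp_apply, slope_def_module]
  rw [Real.coe_toNNReal _ (sub_nonneg.mpr hs.le), hsplit, hT.map_add, ← RCLike.ofReal_inv,
    ← RCLike.real_smul_eq_coe_smul, mul_apply_eq_comp]

variable [CompleteSpace X]

lemma generatorGraph_integral_orbit (hT : IsC0Semigroup T) (x : X) {t : ℝ} (ht : 0 ≤ t) :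
    generatorGraph T (∫ s in (0 : ℝ)..t, T s.toNNReal x) (T t.toNNReal x - x) := by
  have hcont := hT.continuous_orbit_toNNReal x
  set F : ℝ → X := fun u => ∫ s in (0 : ℝ)..u, T s.toNNReal x with hF
  have hF' : ∀ u, HasDerivAt F (T u.toNNReal x) u := fun u =>
    (hcont.integral_hasStrictDerivAt 0 u).hasDerivAt
  have hdiff : HasDerivAt (fun r => F (t + r) - F r) (T t.toNNReal x - x) 0 := by
    have h0 := hF' 0
    rw [Real.toNNReal_zero, hT.map_zero, one_apply_eq_self] at h0
    exact (HasDerivAt.comp_const_add t 0 (by simpa using hF' t)).sub h0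
  have hslope := (hasDerivAt_iff_tendsto_slope.mp hdiff).mono_left
    (nhdsWithin_mono 0 fun u (hu : 0 < u) => hu.ne')
  refine (hslope.comp tendsto_coe_nnreal_nhdsGT_zero).congr fun r => ?_
  have hsub : F (t + r) - F r = T r (F t) := by
    rw [hF, hT.apply_integral_orbit x ht]
    exact intervalIntegral.integral_interval_sub_left (hcont.intervalIntegrable _ _)
      (hcont.intervalIntegrable _ _)
  rw [← RCLike.ofReal_inv, ← RCLike.real_smul_eq_coe_smul, ← hsub]
  simp [slope_def_module, hF]

lemma dense_generatorGraph_domain (hT : IsC0Semigroup T) :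
    Dense {x | ∃ y, generatorGraph T x y} := by
  intro x
  have haverage : Tendsto (fun t : ℝ => t⁻¹ • ∫ s in (0 : ℝ)..t, T s.toNNReal x)
      (𝓝[>] 0) (𝓝 x) := by
    have hderiv := ((hT.continuous_orbit_toNNReal x).integral_hasStrictDerivAt 0 0).hasDerivAt
    rw [Real.toNNReal_zero, hT.map_zero, one_apply_eq_self] at hderiv
    have hslope := (hasDerivAt_iff_tendsto_slope.mp hderiv).mono_left
      (nhdsWithin_mono 0 fun u (hu : 0 < u) => hu.ne')
    exact hslope.congr fun t => by simp [slope_def_module]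
  refine mem_closure_of_tendsto haverage (eventually_nhdsWithin_of_forall fun t (ht : 0 < t) => ?_)
  refine ⟨t⁻¹ • (T t.toNNReal x - x), ?_⟩
  have hgraph := (hT.generatorGraph_integral_orbit x ht.le).const_smul ((t⁻¹ : ℝ) : 𝕜)
  simp only [RCLike.real_smul_eq_coe_smul (K := 𝕜)]
  refine hgraph.congr fun r => ?_
  rw [map_smul, ← smul_sub, smul_comm]

end IsC0Semigroup

end Semigroup

/-! ### Weak derivatives on an interval -/

section WeakDerivative

lemma absolutelyContinuousOnInterval_intervalIntegral {E : Type*} [NormedAddCommGroup E]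
    [NormedSpace ℝ E] {w : ℝ → E} {a b c : ℝ} (hw : IntervalIntegrable w volume a b)
    (hc : c ∈ uIcc a b) : AbsolutelyContinuousOnInterval (fun ξ => ∫ ζ in c..ξ, w ζ) a b := by
  have hnorm := hw.norm.absolutelyContinuousOnInterval_intervalIntegral hc
  have hint : ∀ ξ ∈ uIcc a b, IntervalIntegrable w volume c ξ := fun ξ hξ =>
    hw.mono_set (uIcc_subset_uIcc hc hξ)
  refine squeeze_zero' (Eventually.of_forall fun _ => Finset.sum_nonneg fun _ _ => dist_nonneg)
    (eventually_inf_principal.mpr (Eventually.of_forall fun I hI => ?_)) hnorm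
  refine Finset.sum_le_sum fun k hk => ?_
  obtain ⟨h1, h2⟩ := hI.1 k hk
  rw [dist_comm, dist_comm (∫ ζ in c..(I.2 k).1, ‖w ζ‖), dist_eq_norm, Real.dist_eq,
    intervalIntegral.integral_interval_sub_left (hint _ h2) (hint _ h1),
    intervalIntegral.integral_interval_sub_left (hint _ h2).norm (hint _ h1).norm]
  exact intervalIntegral.norm_integral_le_abs_integral_norm

/-- `f' ∈ L¹(a, b)` is the weak derivative of `f` on `[a, b]`, where `f` is the (absolutely)
continuous representative. -/
def HasWeakDerivOn {E : Type*} [NormedAddCommGroup E] [NormedSpace ℝ E] (f f' : ℝ → E)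
    (a b : ℝ) : Prop :=
  IntervalIntegrable f' volume a b ∧ ∀ ξ ∈ Icc a b, f ξ = f a + ∫ ζ in a..ξ, f' ζ

namespace HasWeakDerivOn

variable {E : Type*} [NormedAddCommGroup E] [NormedSpace ℝ E] {f f' : ℝ → E} {a b : ℝ}

lemma intervalIntegrable_of_mem (hf : HasWeakDerivOn f f' a b) {ξ : ℝ} (hξ : ξ ∈ Icc a b) :
    IntervalIntegrable f' volume a ξ :=
  hf.1.mono_set (uIcc_subset_uIcc left_mem_uIcc (Icc_subset_uIcc hξ))

lemma absolutelyContinuousOnInterval (hf : HasWeakDerivOn f f' a b) (hab : a ≤ b) :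
    AbsolutelyContinuousOnInterval f a b := by
  have hconst : AbsolutelyContinuousOnInterval (fun _ => f a) a b :=
    (LipschitzWith.const (f a)).lipschitzOnWith.absolutelyContinuousOnInterval
  have hprim := hconst.fun_add (absolutelyContinuousOnInterval_intervalIntegral hf.1 left_mem_uIcc)
  refine hprim.congr' (eventually_inf_principal.mpr (Eventually.of_forall fun I hI => ?_))
  refine Finset.sum_congr rfl fun k hk => ?_
  obtain ⟨h1, h2⟩ := hI.1 k hk
  rw [uIcc_of_le hab] at h1 h2
  rw [hf.2 _ h1, hf.2 _ h2]

lemma ae_hasDerivAt [CompleteSpace E] (hf : HasWeakDerivOn f f' a b) (hab : a ≤ b) :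
    ∀ᵐ ξ, ξ ∈ Icc a b → HasDerivAt f (f' ξ) ξ := by
  have hne : ∀ᵐ ξ : ℝ, ξ ≠ a ∧ ξ ≠ b := by
    simp only [eventually_and]
    exact ⟨Measure.ae_ne volume a, Measure.ae_ne volume b⟩
  have hprim := hf.1.ae_hasDerivAt_integral
  rw [uIcc_of_le hab] at hprim
  filter_upwards [hne, hprim] with ξ ⟨hξa, hξb⟩ hξ' hξ
  have hnhds : Icc a b ∈ 𝓝 ξ :=
    Icc_mem_nhds (lt_of_le_of_ne hξ.1 hξa.symm) (lt_of_le_of_ne hξ.2 hξb)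
  exact ((hξ' hξ a (left_mem_Icc.mpr hab)).const_add (f a)).congr_of_eventuallyEq
    (eventually_of_mem hnhds hf.2)

lemma of_absolutelyContinuousOnInterval [CompleteSpace E] (hab : a ≤ b)
    (hf : AbsolutelyContinuousOnInterval f a b) (hf' : IntervalIntegrable f' volume a b)
    (hderiv : ∀ᵐ ξ, ξ ∈ Icc a b → HasDerivAt f (f' ξ) ξ) : HasWeakDerivOn f f' a b := by
  have hgap := hf.fun_sub (absolutelyContinuousOnInterval_intervalIntegral hf' left_mem_uIcc)
  obtain ⟨C, hC⟩ := hgap.const_of_ae_hasDerivAt_zero <| by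
    filter_upwards [hderiv, hf'.ae_hasDerivAt_integral] with ξ hξ hξ' hmem
    have hsub := (hξ (uIcc_of_le hab ▸ hmem)).fun_sub (hξ' hmem a left_mem_uIcc)
    rwa [sub_self] at hsub
  refine ⟨hf', fun ξ hξ => ?_⟩
  have hCa := hC a left_mem_uIcc
  have hCξ := hC ξ (uIcc_of_le hab ▸ hξ)
  rw [intervalIntegral.integral_same, sub_zero] at hCa
  rw [hCa, ← hCξ, sub_add_cancel]

lemma of_hasDerivWithinAt [CompleteSpace E]
    (hf : ∀ ξ ∈ Icc a b, HasDerivWithinAt f (f' ξ) (Icc a b) ξ)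
    (hf' : ContinuousOn f' (Icc a b)) (hab : a ≤ b) : HasWeakDerivOn f f' a b := by
  refine ⟨hf'.intervalIntegrable_of_Icc hab, fun ξ hξ => ?_⟩
  have hsub : Icc a ξ ⊆ Icc a b := Icc_subset_Icc_right hξ.2
  rw [intervalIntegral.integral_eq_sub_of_hasDerivAt_of_le hξ.1
    (fun ζ hζ => ((hf ζ (hsub hζ)).continuousWithinAt.mono hsub))
    (fun ζ hζ => (hf ζ (hsub (Ioo_subset_Icc_self hζ))).hasDerivAt
      (Icc_mem_nhds hζ.1 (hζ.2.trans_le hξ.2)))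
    ((hf'.mono hsub).intervalIntegrable_of_Icc hξ.1), add_sub_cancel]

lemma clm_comp {F : Type*} [NormedAddCommGroup F] [NormedSpace ℝ F] [CompleteSpace E]
    [CompleteSpace F] (L : E →L[ℝ] F) (hf : HasWeakDerivOn f f' a b) :
    HasWeakDerivOn (fun ξ => L (f ξ)) (fun ξ => L (f' ξ)) a b := by
  refine ⟨⟨L.integrable_comp hf.1.1, L.integrable_comp hf.1.2⟩, fun ξ hξ => ?_⟩
  beta_reduce
  rw [L.intervalIntegral_comp_comm (hf.intervalIntegrable_of_mem hξ), hf.2 ξ hξ, map_add]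

lemma sum {ι : Type*} {s : Finset ι} {f f' : ι → ℝ → E}
    (hf : ∀ i ∈ s, HasWeakDerivOn (f i) (f' i) a b) :
    HasWeakDerivOn (fun ξ => ∑ i ∈ s, f i ξ) (fun ξ => ∑ i ∈ s, f' i ξ) a b := by
  refine ⟨by simpa only [Finset.sum_fn] using IntervalIntegrable.sum s fun i hi => (hf i hi).1,
    fun ξ hξ => ?_⟩
  rw [intervalIntegral.integral_finsetSum fun i hi => (hf i hi).intervalIntegrable_of_mem hξ,
    ← Finset.sum_add_distrib]
  exact Finset.sum_congr rfl fun i hi => (hf i hi).2 ξ hξ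

lemma mul {𝕜 : Type*} [RCLike 𝕜] {f f' g g' : ℝ → 𝕜} (hab : a ≤ b)
    (hf : HasWeakDerivOn f f' a b) (hg : HasWeakDerivOn g g' a b) :
    HasWeakDerivOn (fun ξ => f ξ * g ξ) (fun ξ => f' ξ * g ξ + f ξ * g' ξ) a b := by
  have hfac := hf.absolutelyContinuousOnInterval hab
  have hgac := hg.absolutelyContinuousOnInterval hab
  refine of_absolutelyContinuousOnInterval hab (hfac.fun_smul hgac)
    ((hf.1.mul_continuousOn hgac.continuousOn).add (hg.1.continuousOn_mul hfac.continuousOn)) ?_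
  filter_upwards [hf.ae_hasDerivAt hab, hg.ae_hasDerivAt hab] with ξ hfξ hgξ hξ
  exact (hfξ hξ).mul (hgξ hξ)

lemma congr_ae {g' : ℝ → E} (hf : HasWeakDerivOn f f' a b) (hab : a ≤ b)
    (h : ∀ᵐ ξ ∂volume.restrict (Icc a b), f' ξ = g' ξ) : HasWeakDerivOn f g' a b := by
  have hae : ∀ ξ ∈ Icc a b, f' =ᵐ[volume.restrict (uIoc a ξ)] g' := fun ξ hξ => by
    rw [uIoc_of_le hξ.1]
    exact ae_restrict_of_ae_restrict_of_subset
      (Ioc_subset_Icc_self.trans (Icc_subset_Icc_right hξ.2)) h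
  refine ⟨hf.1.congr_ae (hae b (right_mem_Icc.mpr hab)), fun ξ hξ => ?_⟩
  rw [hf.2 ξ hξ, intervalIntegral.integral_congr_ae_restrict (hae ξ hξ)]

end HasWeakDerivOn

end WeakDerivative

/-! ### Derivatives of matrix valued functions -/

section MatrixDerivative

variable {ι 𝕜 : Type*} [Fintype ι] [RCLike 𝕜]

lemma differentiableWithinAt_det [DecidableEq ι] {A : ℝ → Matrix ι ι 𝕜} {s : Set ℝ} {ξ : ℝ}
    (hA : ∀ i j, DifferentiableWithinAt ℝ (fun ζ => A ζ i j) s ξ) :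
    DifferentiableWithinAt ℝ (fun ζ => (A ζ).det) s ξ := by
  simp_rw [Matrix.det_apply]
  exact DifferentiableWithinAt.fun_sum fun σ _ =>
    (DifferentiableWithinAt.fun_finsetProd fun i _ => hA _ _).const_smul _

lemma differentiableWithinAt_inv_apply [DecidableEq ι] {A : ℝ → Matrix ι ι 𝕜} {s : Set ℝ} {ξ : ℝ}
    (hA : ∀ i j, DifferentiableWithinAt ℝ (fun ζ => A ζ i j) s ξ) (hu : IsUnit (A ξ))
    (i j : ι) : DifferentiableWithinAt ℝ (fun ζ => (A ζ)⁻¹ i j) s ξ := by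
  simp_rw [Matrix.inv_def, Ring.inverse_eq_inv', Matrix.smul_apply, smul_eq_mul,
    Matrix.adjugate_apply]
  have hdet : (A ξ).det ≠ 0 := ((Matrix.isUnit_iff_isUnit_det _).mp hu).ne_zero
  refine ((differentiableWithinAt_det hA).inv hdet).mul (differentiableWithinAt_det fun k l => ?_)
  simp_rw [Matrix.updateRow_apply]
  split_ifs
  · exact differentiableWithinAt_const _
  · exact hA k l

lemma hasDerivWithinAt_matrix_mul_apply {A B : ℝ → Matrix ι ι 𝕜} {A' B' : Matrix ι ι 𝕜}
    {s : Set ℝ} {ξ : ℝ} (hA : ∀ i j, HasDerivWithinAt (fun ζ => A ζ i j) (A' i j) s ξ)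
    (hB : ∀ i j, HasDerivWithinAt (fun ζ => B ζ i j) (B' i j) s ξ) (i j : ι) :
    HasDerivWithinAt (fun ζ => (A ζ * B ζ) i j) ((A' * B ξ + A ξ * B') i j) s ξ := by
  simp_rw [Matrix.add_apply, Matrix.mul_apply, ← Finset.sum_add_distrib]
  exact HasDerivWithinAt.fun_sum fun k _ => (hA i k).mul (hB k j)

end MatrixDerivative

namespace HBCS.Diagonalisation

variable {𝕜 : Type*} [RCLike 𝕜] {n : ℕ} {sys : HBCS 𝕜 n} (D : sys.Diagonalisation)

/-- The entrywise derivative of `S` on `[a, b]`. -/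
def derivS (ξ : ℝ) : Matrix (Fin n) (Fin n) 𝕜 :=
  Matrix.of fun i j => derivWithin (fun ζ => D.S ζ i j) (Icc sys.a sys.b) ξ

lemma hasDerivWithinAt_S {ξ : ℝ} (hξ : ξ ∈ Icc sys.a sys.b) (i j : Fin n) :
    HasDerivWithinAt (fun ζ => D.S ζ i j) (D.derivS ξ i j) (Icc sys.a sys.b) ξ :=
  ((D.S_contDiff i j).differentiableOn one_ne_zero ξ hξ).hasDerivWithinAt

lemma continuousOn_derivS (i j : Fin n) :
    ContinuousOn (fun ζ => D.derivS ζ i j) (Icc sys.a sys.b) :=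
  (D.S_contDiff i j).continuousOn_derivWithin (uniqueDiffOn_Icc sys.hab) le_rfl

lemma hasDerivWithinAt_S_inv {ξ : ℝ} (hξ : ξ ∈ Icc sys.a sys.b) (i j : Fin n) :
    HasDerivWithinAt (fun ζ => (D.S ζ)⁻¹ i j) (D.derivSInv ξ i j) (Icc sys.a sys.b) ξ :=
  (differentiableWithinAt_inv_apply
    (fun i j => (D.hasDerivWithinAt_S hξ i j).differentiableWithinAt) (D.S_unit ξ hξ) i
    j).hasDerivWithinAt

lemma S_inv_mul {ξ : ℝ} (hξ : ξ ∈ Icc sys.a sys.b) : (D.S ξ)⁻¹ * D.S ξ = 1 :=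
  Matrix.nonsing_inv_mul _ ((Matrix.isUnit_iff_isUnit_det _).mp (D.S_unit ξ hξ))

lemma S_mul_inv {ξ : ℝ} (hξ : ξ ∈ Icc sys.a sys.b) : D.S ξ * (D.S ξ)⁻¹ = 1 :=
  Matrix.mul_nonsing_inv _ ((Matrix.isUnit_iff_isUnit_det _).mp (D.S_unit ξ hξ))

lemma derivSInv_mul_add {ξ : ℝ} (hξ : ξ ∈ Icc sys.a sys.b) :
    D.derivSInv ξ * D.S ξ + (D.S ξ)⁻¹ * D.derivS ξ = 0 := by
  ext i j
  have hprod := hasDerivWithinAt_matrix_mul_apply (fun i j => D.hasDerivWithinAt_S_inv hξ i j)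
    (fun i j => D.hasDerivWithinAt_S hξ i j) i j
  have hconst : HasDerivWithinAt (fun ζ => ((D.S ζ)⁻¹ * D.S ζ) i j) 0 (Icc sys.a sys.b) ξ :=
    (hasDerivWithinAt_const ξ (Icc sys.a sys.b) ((1 : Matrix (Fin n) (Fin n) 𝕜) i j)).congr_of_mem
      (fun ζ hζ => by rw [D.S_inv_mul hζ]) hξ
  exact (uniqueDiffOn_Icc sys.hab ξ hξ).eq_deriv _ hprod hconst

/-- The meaning of `P₀^D = 0`: it makes the zeroth order term of the equation for `S x` cancel. -/
lemma derivS_mul_P1 (hP1 : IsUnit sys.P1) {ξ : ℝ} (hξ : ξ ∈ Icc sys.a sys.b) (h0 : D.P0D ξ = 0) :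
    D.derivS ξ * sys.P1 = D.S ξ * sys.P0 ξ := by
  have hP1' : sys.P1⁻¹ * sys.P1 = 1 :=
    Matrix.nonsing_inv_mul _ ((Matrix.isUnit_iff_isUnit_det _).mp hP1)
  have hzero : D.S ξ * D.derivSInv ξ = -(D.S ξ * (sys.P0 ξ * sys.P1⁻¹ * (D.S ξ)⁻¹)) := by
    refine eq_neg_of_add_eq_zero_left ?_
    rw [← Matrix.mul_add, ← Matrix.mul_one (D.S ξ * _), ← P1D_mul_self D.m, ← Matrix.mul_assoc]
    exact (congrArg (· * P1D 𝕜 n D.m) h0).trans (Matrix.zero_mul _)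
  have hderivS : D.derivS ξ = -(D.S ξ * D.derivSInv ξ * D.S ξ) := by
    refine eq_neg_of_add_eq_zero_right ?_
    rw [← Matrix.one_mul (D.derivS ξ), ← D.S_mul_inv hξ, Matrix.mul_assoc, Matrix.mul_assoc,
      ← Matrix.mul_add, D.derivSInv_mul_add hξ, Matrix.mul_zero]
  calc D.derivS ξ * sys.P1
      = D.S ξ * (sys.P0 ξ * (sys.P1⁻¹ * ((D.S ξ)⁻¹ * D.S ξ * sys.P1))) := by
        simp only [hderivS, hzero, neg_mul, neg_neg, Matrix.mul_assoc]
    _ = D.S ξ * sys.P0 ξ := by rw [D.S_inv_mul hξ, Matrix.one_mul, hP1', Matrix.mul_one]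

end HBCS.Diagonalisation

/-! ### Transport along the characteristics -/

lemma eventually_forall_norm_translate_sub_le {E : Type*} [NormedAddCommGroup E]
    [NormedSpace ℝ E] {ψ : ℝ → E} (hψ : ContDiff ℝ 1 ψ) (hsupp : HasCompactSupport ψ) (t : ℝ)
    {ε : ℝ} (hε : 0 < ε) :
    ∀ᶠ s in 𝓝 t, ∀ r, ‖ψ (s + r) - ψ (t + r) - (s - t) • deriv ψ (t + r)‖ ≤ ε * ‖s - t‖ := by
  have huniform : UniformContinuous (deriv ψ) :=
    (hψ.continuous_deriv le_rfl).uniformContinuous_of_tendsto_cocompact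
      hsupp.deriv.is_zero_at_infty
  obtain ⟨δ, hδ, hδψ⟩ := Metric.uniformContinuous_iff.mp huniform ε hε
  filter_upwards [Metric.ball_mem_nhds t hδ] with s hs r
  have hderiv : ∀ y ∈ segment ℝ t s,
      HasDerivWithinAt (fun y => ψ (y + r) - y • deriv ψ (t + r))
        (deriv ψ (y + r) - deriv ψ (t + r)) (segment ℝ t s) y := fun y _ => by
    have hψy : HasDerivAt (fun y => ψ (y + r)) (deriv ψ (y + r)) y :=
      HasDerivAt.comp_add_const y r ((hψ.differentiable one_ne_zero).differentiableAt.hasDerivAt)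
    have hlin := (hasDerivAt_id y).smul_const (deriv ψ (t + r))
    rw [one_smul] at hlin
    exact (hψy.fun_sub hlin).hasDerivWithinAt
  have hbound : ∀ y ∈ segment ℝ t s, ‖deriv ψ (y + r) - deriv ψ (t + r)‖ ≤ ε := fun y hy => by
    rw [← dist_eq_norm]
    refine (hδψ ?_).le
    rw [dist_add_right]
    exact (convex_ball t δ).segment_subset (Metric.mem_ball_self hδ) hs hy
  refine le_of_eq_of_le (congrArg norm ?_)
    ((convex_segment t s).norm_image_sub_le_of_norm_hasDerivWithin_le hderiv hbound
      (left_mem_segment ℝ t s) (right_mem_segment ℝ t s))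
  rw [sub_smul]
  abel

lemma memLp_restrict_Icc_of_continuousOn {E : Type*} [NormedAddCommGroup E] {f : ℝ → E} {a b : ℝ}
    (hf : ContinuousOn f (Icc a b)) (p : ℝ≥0∞) : MemLp f p (volume.restrict (Icc a b)) := by
  obtain ⟨C, hC⟩ := isCompact_Icc.exists_bound_of_continuousOn hf
  exact MemLp.of_bound (hf.aestronglyMeasurable measurableSet_Icc) C
    (ae_restrict_of_forall_mem measurableSet_Icc hC)

namespace HBCS.Diagonalisation

variable {𝕜 : Type*} [RCLike 𝕜] {n : ℕ} {sys : HBCS 𝕜 n} (D : sys.Diagonalisation)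

/-- The time which the `i`-th component needs to travel from `ξ` to the outflow boundary. -/
def arrival (i : Fin n) (ξ : ℝ) : ℝ :=
  if (i : ℕ) < D.m then ∫ ζ in sys.a..ξ, D.slowness i ζ else ∫ ζ in ξ..sys.b, D.slowness i ζ

lemma hasDerivAt_arrival (i : Fin n) (ξ : ℝ) :
    HasDerivAt (D.arrival i) (D.sgn i * D.slowness i ξ) ξ := by
  unfold arrival sgn
  split_ifs
  · rw [one_mul]
    exact ((D.continuous_slowness i).integral_hasStrictDerivAt _ ξ).hasDerivAt
  · rw [neg_one_mul]
    simp_rw [intervalIntegral.integral_symm sys.b]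
    exact ((D.continuous_slowness i).integral_hasStrictDerivAt sys.b ξ).hasDerivAt.neg

lemma continuous_arrival (i : Fin n) : Continuous (D.arrival i) :=
  continuous_iff_continuousAt.mpr fun ξ => (D.hasDerivAt_arrival i ξ).continuousAt

lemma arrival_nonneg (i : Fin n) {ξ : ℝ} (hξ : ξ ∈ Icc sys.a sys.b) : 0 ≤ D.arrival i ξ := by
  unfold arrival
  split_ifs
  · exact intervalIntegral.integral_nonneg hξ.1 fun ζ _ => (D.slowness_pos i ζ).le
  · exact intervalIntegral.integral_nonneg hξ.2 fun ζ _ => (D.slowness_pos i ζ).le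

lemma arrival_a (i : Fin n) :
    D.arrival i sys.a = if (i : ℕ) < D.m then 0 else D.travelTime i := by
  simp [arrival, travelTime]

lemma arrival_b (i : Fin n) :
    D.arrival i sys.b = if (i : ℕ) < D.m then D.travelTime i else 0 := by
  simp [arrival, travelTime]

/-- The `i`-th row of `S`, conjugated since the inner product is conjugate linear in its first
argument. -/
def row (i : Fin n) (ξ : ℝ) : EuclideanSpace 𝕜 (Fin n) :=
  WithLp.toLp 2 fun j => star (D.S ξ i j)

lemma inner_row (i : Fin n) (ξ : ℝ) (x : EuclideanSpace 𝕜 (Fin n)) :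
    inner 𝕜 (D.row i ξ) x = (D.S ξ *ᵥ x.ofLp) i := by
  simp [row, PiLp.inner_apply, Matrix.mulVec, dotProduct, mul_comm]

lemma continuousOn_row (i : Fin n) : ContinuousOn (D.row i) (Icc sys.a sys.b) :=
  (PiLp.continuous_toLp 2 _).comp_continuousOn <| continuousOn_pi.mpr fun j =>
    continuous_star.comp_continuousOn (D.S_contDiff i j).continuousOn

lemma memLp_smul_row (i : Fin n) (φ : C(ℝ, ℝ)) : MemLp (fun ξ => φ ξ • D.row i ξ) 2 sys.vol :=
  memLp_restrict_Icc_of_continuousOn (φ.continuous.continuousOn.smul (D.continuousOn_row i)) 2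

/-- The element `φ Sᵢ` of the state space which represents the functional `x ↦ ∫ φ (S x)ᵢ`. -/
def testVec (i : Fin n) : C(ℝ, ℝ) →ₗ[ℝ] sys.State where
  toFun φ := (D.memLp_smul_row i φ).toLp _
  map_add' φ ψ := by
    rw [← MemLp.toLp_add]
    congr 1
    ext1 ξ
    exact add_smul _ _ _
  map_smul' c φ := by
    rw [RingHom.id_apply, ← MemLp.toLp_const_smul]
    congr 1
    ext1 ξ
    exact mul_smul _ _ _

lemma coeFn_testVec (i : Fin n) (φ : C(ℝ, ℝ)) :
    D.testVec i φ =ᵐ[sys.vol] fun ξ => φ ξ • D.row i ξ :=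
  MemLp.coeFn_toLp (D.memLp_smul_row i φ)

lemma inner_testVec_ae_eq (i : Fin n) (φ : C(ℝ, ℝ)) (x : sys.State) :
    (fun ξ => inner 𝕜 (D.testVec i φ ξ) (x ξ)) =ᵐ[sys.vol]
      fun ξ => (φ ξ : 𝕜) * (D.S ξ *ᵥ (x ξ).ofLp) i := by
  filter_upwards [D.coeFn_testVec i φ] with ξ hξ
  rw [hξ, RCLike.real_smul_eq_coe_smul (K := 𝕜), inner_smul_left, RCLike.conj_ofReal, D.inner_row]

lemma inner_testVec (i : Fin n) (φ : C(ℝ, ℝ)) (x : sys.State) :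
    inner 𝕜 (D.testVec i φ) x = ∫ ξ, (φ ξ : 𝕜) * (D.S ξ *ᵥ (x ξ).ofLp) i ∂sys.vol := by
  rw [L2.inner_def]
  exact integral_congr_ae (D.inner_testVec_ae_eq i φ x)

lemma integrable_mul_S_mulVec (i : Fin n) (φ : C(ℝ, ℝ)) (x : sys.State) :
    Integrable (fun ξ => (φ ξ : 𝕜) * (D.S ξ *ᵥ (x ξ).ofLp) i) sys.vol :=
  (L2.integrable_inner (𝕜 := 𝕜) (D.testVec i φ) x).congr (D.inner_testVec_ae_eq i φ x)

lemma norm_testVec_le (i : Fin n) {φ : C(ℝ, ℝ)} {C : ℝ} (hφ : ∀ ξ, ‖φ ξ‖ ≤ C) :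
    ‖D.testVec i φ‖ ≤ C * ‖D.testVec i 1‖ := by
  refine Lp.norm_le_mul_norm_of_ae_le_mul ?_
  filter_upwards [D.coeFn_testVec i φ, D.coeFn_testVec i 1] with ξ hφξ hξ
  rw [hφξ, hξ, ContinuousMap.one_apply, one_smul, norm_smul]
  exact mul_le_mul_of_nonneg_right (hφ ξ) (norm_nonneg _)

/-- The family of test vectors obtained from `ψ` by translation along the characteristics. -/
def shiftVec (i : Fin n) (ψ : C(ℝ, ℝ)) (t : ℝ) : sys.State :=
  D.testVec i (ψ.comp ⟨fun ξ => t + D.arrival i ξ, continuous_const.add (D.continuous_arrival i)⟩)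

lemma hasDerivAt_shiftVec (i : Fin n) {ψ : ℝ → ℝ} (hψ : ContDiff ℝ 1 ψ)
    (hsupp : HasCompactSupport ψ) (t : ℝ) :
    HasDerivAt (D.shiftVec i ⟨ψ, hψ.continuous⟩)
      (D.shiftVec i ⟨deriv ψ, hψ.continuous_deriv le_rfl⟩ t) t := by
  rw [hasDerivAt_iff_isLittleO, Asymptotics.isLittleO_iff]
  intro ε hε
  set R := ‖D.testVec i 1‖
  have hε' : 0 < ε / (R + 1) := by positivity
  filter_upwards [eventually_forall_norm_translate_sub_le hψ hsupp t hε'] with s hs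
  rw [shiftVec, shiftVec, shiftVec, ← map_smul, ← map_sub, ← map_sub]
  calc _ ≤ ε / (R + 1) * ‖s - t‖ * R := D.norm_testVec_le i fun ξ => hs (D.arrival i ξ)
    _ = ε * ‖s - t‖ * (R / (R + 1)) := by ring
    _ ≤ ε * ‖s - t‖ := mul_le_of_le_one_right (by positivity)
        (div_le_one_of_le₀ (by linarith) (by positivity))

/-- The effort variable `v^D = P₁^D S P₁ v` of the diagonalised system. -/
def effort (v : ℝ → EuclideanSpace 𝕜 (Fin n)) (ξ : ℝ) : Fin n → 𝕜 :=
  P1D 𝕜 n D.m *ᵥ (D.S ξ *ᵥ (sys.P1 *ᵥ (v ξ).ofLp))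

/-- The components of the effort at the boundary through which they enter. -/
def inflow (v : ℝ → EuclideanSpace 𝕜 (Fin n)) (i : Fin n) : 𝕜 :=
  if (i : ℕ) < D.m then D.effort v sys.b i else D.effort v sys.a i

/-- The components of the effort at the boundary through which they leave. -/
def outflow (v : ℝ → EuclideanSpace 𝕜 (Fin n)) (i : Fin n) : 𝕜 :=
  if (i : ℕ) < D.m then D.effort v sys.a i else D.effort v sys.b i

lemma effort_apply (v : ℝ → EuclideanSpace 𝕜 (Fin n)) (ξ : ℝ) (i : Fin n) :
    D.effort v ξ i = (D.sgn i : 𝕜) * (D.S ξ *ᵥ (sys.P1 *ᵥ (v ξ).ofLp)) i := by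
  rw [effort, D.P1D_eq_diagonal_sgn, Matrix.mulVec_diagonal]

lemma S_mulVec_state {x z : sys.State} {v : ℝ → EuclideanSpace 𝕜 (Fin n)}
    (hev : sys.Evolution x z v) (i : Fin n) :
    ∀ᵐ ξ ∂sys.vol, (D.S ξ *ᵥ (x ξ).ofLp) i =
      ((D.sgn i * D.slowness i ξ : ℝ) : 𝕜) * (D.S ξ *ᵥ (sys.P1 *ᵥ (v ξ).ofLp)) i := by
  obtain ⟨w, -, hx, -⟩ := hev
  filter_upwards [hx, D.eq, ae_restrict_mem measurableSet_Icc] with ξ hv heq hξ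
  have hconj : D.S ξ * (sys.P1 * sys.H ξ) =
      P1D 𝕜 n D.m * Matrix.diagonal (fun i => (D.h ξ i : 𝕜)) * D.S ξ := by
    rw [heq]
    simp only [← Matrix.mul_assoc]
    rw [D.S_mul_inv hξ, Matrix.one_mul]
  have hscalar : D.sgn i * D.slowness i ξ * (D.sgn i * D.h ξ i) = 1 := by
    rw [mul_mul_mul_comm, D.sgn_mul_self, D.slowness_eq i hξ, inv_mul_cancel₀ (D.h_pos ξ hξ i).ne',
      one_mul]
  rw [hv, Matrix.mulVec_mulVec, Matrix.mulVec_mulVec, Matrix.mul_assoc, hconj,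
    D.P1D_eq_diagonal_sgn, Matrix.diagonal_mul_diagonal, ← Matrix.mulVec_mulVec,
    Matrix.mulVec_diagonal, ← mul_assoc, ← RCLike.ofReal_mul, ← RCLike.ofReal_mul, hscalar,
    RCLike.ofReal_one, one_mul]

lemma hasWeakDerivOn_S_mulVec (hP1 : IsUnit sys.P1) (hP0 : ∀ᵐ ξ ∂sys.vol, D.P0D ξ = 0)
    {x z : sys.State} {v : ℝ → EuclideanSpace 𝕜 (Fin n)} (hev : sys.Evolution x z v)
    (i : Fin n) :
    HasWeakDerivOn (fun ξ => (D.S ξ *ᵥ (sys.P1 *ᵥ (v ξ).ofLp)) i)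
      (fun ξ => (D.S ξ *ᵥ (z ξ).ofLp) i) sys.a sys.b := by
  obtain ⟨w, ⟨hw, hv⟩, -, hz⟩ := hev
  have hvw : HasWeakDerivOn v w sys.a sys.b :=
    ⟨(intervalIntegrable_iff_integrableOn_Icc_of_le sys.hab.le).mpr (hw.integrable one_le_two), hv⟩
  have hcoeff (j) : HasWeakDerivOn (fun ξ => (D.S ξ * sys.P1) i j)
      (fun ξ => (D.derivS ξ * sys.P1) i j) sys.a sys.b := by
    simp_rw [Matrix.mul_apply]
    exact .of_hasDerivWithinAt
      (fun ξ hξ => HasDerivWithinAt.fun_sum fun k _ => (D.hasDerivWithinAt_S hξ i k).mul_const _)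
      (continuousOn_finsetSum _ fun k _ => (D.continuousOn_derivS i k).mul continuousOn_const)
      sys.hab.le
  have hprod := HasWeakDerivOn.sum (s := Finset.univ) fun j _ => (hcoeff j).mul sys.hab.le <|
    hvw.clm_comp ((EuclideanSpace.proj j : EuclideanSpace 𝕜 (Fin n) →L[𝕜] 𝕜).restrictScalars ℝ)
  simp_rw [Matrix.mulVec_mulVec]
  refine hprod.congr_ae sys.hab.le ?_
  filter_upwards [hP0, hz, ae_restrict_mem measurableSet_Icc] with ξ h0 hz hξ
  rw [hz, Finset.sum_add_distrib, Matrix.mulVec_add, Matrix.mulVec_mulVec, Matrix.mulVec_mulVec,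
    ← D.derivS_mul_P1 hP1 hξ h0, add_comm]
  rfl

lemma hasWeakDerivOn_comp_arrival (i : Fin n) {ψ : ℝ → ℝ} (hψ : ContDiff ℝ 1 ψ) (t : ℝ) :
    HasWeakDerivOn (fun ξ => (ψ (t + D.arrival i ξ) : 𝕜))
      (fun ξ => ((deriv ψ (t + D.arrival i ξ) * (D.sgn i * D.slowness i ξ) : ℝ) : 𝕜))
      sys.a sys.b := by
  refine .of_hasDerivWithinAt (fun ξ _ => ?_) (Continuous.continuousOn ?_) sys.hab.le
  · have hψξ : HasDerivAt ψ _ (t + D.arrival i ξ) :=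
      (hψ.differentiable one_ne_zero).differentiableAt.hasDerivAt
    exact ((RCLike.ofRealCLM (K := 𝕜)).hasFDerivAt.comp_hasDerivAt ξ
      (hψξ.comp ξ ((D.hasDerivAt_arrival i ξ).const_add t))).hasDerivWithinAt
  · exact RCLike.continuous_ofReal.comp <|
      ((hψ.continuous_deriv le_rfl).comp (continuous_const.add (D.continuous_arrival i))).mul
        (continuous_const.mul (D.continuous_slowness i))

/-- The balance law obtained by testing the evolution equation with a function that is transported
along the characteristics. -/
lemma inner_shiftVec_balance (hP1 : IsUnit sys.P1)
    (hP0 : ∀ᵐ ξ ∂sys.vol, D.P0D ξ = 0) {x z : sys.State} {v : ℝ → EuclideanSpace 𝕜 (Fin n)}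
    (hev : sys.Evolution x z v) (i : Fin n) {ψ : ℝ → ℝ} (hψ : ContDiff ℝ 1 ψ) (t : ℝ) :
    inner 𝕜 (D.shiftVec i ⟨ψ, hψ.continuous⟩ t) z +
        inner 𝕜 (D.shiftVec i ⟨deriv ψ, hψ.continuous_deriv le_rfl⟩ t) x =
      (ψ (t + D.travelTime i) : 𝕜) * D.inflow v i - (ψ t : 𝕜) * D.outflow v i := by
  have hprod := ((D.hasWeakDerivOn_comp_arrival i hψ t).mul sys.hab.le
    (D.hasWeakDerivOn_S_mulVec hP1 hP0 hev i)).2 sys.b (right_mem_Icc.mpr sys.hab.le)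
  have hintegral : inner 𝕜 (D.shiftVec i ⟨ψ, hψ.continuous⟩ t) z +
      inner 𝕜 (D.shiftVec i ⟨deriv ψ, hψ.continuous_deriv le_rfl⟩ t) x =
      ∫ ξ in sys.a..sys.b, (((deriv ψ (t + D.arrival i ξ) * (D.sgn i * D.slowness i ξ) : ℝ) : 𝕜) *
        (D.S ξ *ᵥ (sys.P1 *ᵥ (v ξ).ofLp)) i +
        (ψ (t + D.arrival i ξ) : 𝕜) * (D.S ξ *ᵥ (z ξ).ofLp) i) := by
    rw [shiftVec, shiftVec, inner_testVec, inner_testVec,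
      ← integral_add (D.integrable_mul_S_mulVec i _ z) (D.integrable_mul_S_mulVec i _ x),
      intervalIntegral.integral_of_le sys.hab.le, ← integral_Icc_eq_integral_Ioc]
    refine integral_congr_ae ?_
    filter_upwards [D.S_mulVec_state hev i] with ξ hξ
    rw [hξ, add_comm, ← mul_assoc, ← RCLike.ofReal_mul]
    rfl
  rw [hintegral, ← sub_eq_iff_eq_add'.mpr hprod]
  simp only [arrival_a, arrival_b, inflow, outflow, effort_apply, sgn]
  split_ifs
  · simp
  · simp only [add_zero, RCLike.ofReal_neg, RCLike.ofReal_one]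
    ring

lemma hasDerivWithinAt_inner_shiftVec (hP1 : IsUnit sys.P1)
    (hP0 : ∀ᵐ ξ ∂sys.vol, D.P0D ξ = 0) {X : ℝ → sys.State} {z : sys.State}
    {v : ℝ → EuclideanSpace 𝕜 (Fin n)} {t : ℝ} (hX : HasDerivWithinAt X z (Ici t) t)
    (hev : sys.Evolution (X t) z v) (i : Fin n) {ψ : ℝ → ℝ} (hψ : ContDiff ℝ 1 ψ)
    (hsupp : HasCompactSupport ψ) :
    HasDerivWithinAt (fun s => inner 𝕜 (D.shiftVec i ⟨ψ, hψ.continuous⟩ s) (X s))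
      ((ψ (t + D.travelTime i) : 𝕜) * D.inflow v i - (ψ t : 𝕜) * D.outflow v i) (Ici t) t := by
  rw [← D.inner_shiftVec_balance hP1 hP0 hev i hψ t]
  exact HasDerivWithinAt.inner 𝕜 (D.hasDerivAt_shiftVec i hψ hsupp t).hasDerivWithinAt hX

end HBCS.Diagonalisation

/-! ### Boundary conditions in terms of inflow and outflow -/

lemma vecMul_injective_of_rank_eq_card {𝕜 ι κ : Type*} [Field 𝕜] [Fintype ι] [Fintype κ]
    {W : Matrix ι κ 𝕜} (hW : W.rank = Fintype.card ι) : Function.Injective W.vecMul := by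
  rw [Matrix.vecMul_injective_iff, linearIndependent_iff_card_eq_finrank_span, ← hW,
    Matrix.rank_eq_finrank_span_row, Set.finrank]

lemma rank_eq_card_of_rank_fromRows {𝕜 ι ι' κ : Type*} [Field 𝕜] [Fintype ι] [Fintype ι']
    [Fintype κ] {A : Matrix ι κ 𝕜} {B : Matrix ι' κ 𝕜}
    (h : (Matrix.fromRows A B).rank = Fintype.card ι + Fintype.card ι') :
    A.rank = Fintype.card ι := by
  have hrow : LinearIndependent 𝕜 (Matrix.fromRows A B).row := Matrix.vecMul_injective_iff.mp <|
    vecMul_injective_of_rank_eq_card (h.trans Fintype.card_sum.symm)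
  exact (hrow.comp Sum.inl Sum.inl_injective).rank_matrix

namespace HBCS.Diagonalisation

variable {𝕜 : Type*} [RCLike 𝕜] {n : ℕ} {sys : HBCS 𝕜 n} (D : sys.Diagonalisation)

/-- The involution which maps the pair of inflow and outflow to the pair of efforts at `b` and at
`a`. -/
def exchange : Matrix (Fin n ⊕ Fin n) (Fin n ⊕ Fin n) 𝕜 :=
  Matrix.fromBlocks D.system.Qplus D.system.Qminus D.system.Qminus D.system.Qplus

lemma exchange_mul_self : D.exchange * D.exchange = 1 := by
  rw [exchange, Matrix.fromBlocks_multiply, D.system_Qplus, D.system_Qminus,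
    ← Matrix.fromBlocks_one, ← Matrix.diagonal_one, ← Matrix.diagonal_zero]
  simp only [Matrix.diagonal_mul_diagonal, Matrix.diagonal_add]
  congr 2 <;> ext i <;> split_ifs <;> simp

lemma fromCols_one_neg_mul_exchange (M : Matrix (Fin n) (Fin n) 𝕜) :
    (Matrix.fromCols 1 (-M) : Matrix (Fin n) (Fin n ⊕ Fin n) 𝕜) * D.exchange =
      Matrix.fromCols (D.system.Qplus - M * D.system.Qminus)
        (D.system.Qminus - M * D.system.Qplus) := by
  simp only [exchange, Matrix.fromCols_mul_fromBlocks, Matrix.one_mul, Matrix.neg_mul,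
    ← sub_eq_add_neg]

lemma exchange_mulVec (v : ℝ → EuclideanSpace 𝕜 (Fin n)) :
    D.exchange *ᵥ Sum.elim (D.inflow v) (D.outflow v) =
      Sum.elim (D.effort v sys.b) (D.effort v sys.a) := by
  rw [exchange, Matrix.fromBlocks_mulVec, Sum.elim_comp_inl, Sum.elim_comp_inr, D.system_Qplus,
    D.system_Qminus]
  congr 1 <;> ext i <;>
    rw [Pi.add_apply, Matrix.mulVec_diagonal, Matrix.mulVec_diagonal, inflow, outflow] <;>
    split_ifs <;> simp

lemma isUnit_boundaryTransform (hP1 : IsUnit sys.P1) : IsUnit D.boundaryTransform := by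
  have hblock {ξ : ℝ} (hξ : ξ ∈ Icc sys.a sys.b) :
      IsUnit (sys.P1⁻¹ * (D.S ξ)⁻¹ * P1D 𝕜 n D.m).det :=
    (Matrix.isUnit_iff_isUnit_det _).mp <|
      ((Matrix.isUnit_nonsing_inv_iff.mpr hP1).mul
        (Matrix.isUnit_nonsing_inv_iff.mpr (D.S_unit ξ hξ))).mul
        (IsUnit.of_mul_eq_one _ (P1D_mul_self D.m))
  rw [Matrix.isUnit_iff_isUnit_det, boundaryTransform, Matrix.det_fromBlocks_zero₂₁]
  exact (hblock (right_mem_Icc.mpr sys.hab.le)).mul (hblock (left_mem_Icc.mpr sys.hab.le))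

lemma boundaryTransform_mulVec_effort (hP1 : IsUnit sys.P1) (v : ℝ → EuclideanSpace 𝕜 (Fin n)) :
    D.boundaryTransform *ᵥ Sum.elim (D.effort v sys.b) (D.effort v sys.a) = sys.trace v := by
  have hblock {ξ : ℝ} (hξ : ξ ∈ Icc sys.a sys.b) :
      (sys.P1⁻¹ * (D.S ξ)⁻¹ * P1D 𝕜 n D.m) *ᵥ D.effort v ξ = (v ξ).ofLp := by
    rw [effort, Matrix.mulVec_mulVec, Matrix.mulVec_mulVec, Matrix.mulVec_mulVec,
      Matrix.mul_assoc (sys.P1⁻¹ * _), P1D_mul_self, Matrix.mul_one, Matrix.mul_assoc sys.P1⁻¹,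
      D.S_inv_mul hξ, Matrix.mul_one,
      Matrix.nonsing_inv_mul _ ((Matrix.isUnit_iff_isUnit_det _).mp hP1), Matrix.one_mulVec]
  rw [boundaryTransform, Matrix.fromBlocks_mulVec, Sum.elim_comp_inl, Sum.elim_comp_inr,
    Matrix.zero_mulVec, Matrix.zero_mulVec, add_zero, zero_add,
    hblock (right_mem_Icc.mpr sys.hab.le), hblock (left_mem_Icc.mpr sys.hab.le), trace]

/-- The matrix which maps the pair of inflow and outflow to the boundary trace. -/
def traceMatrix : Matrix (Fin n ⊕ Fin n) (Fin n ⊕ Fin n) 𝕜 :=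
  D.boundaryTransform * D.exchange

lemma isUnit_traceMatrix (hP1 : IsUnit sys.P1) : IsUnit D.traceMatrix :=
  (D.isUnit_boundaryTransform hP1).mul (IsUnit.of_mul_eq_one _ D.exchange_mul_self)

lemma traceMatrix_mulVec (hP1 : IsUnit sys.P1) (v : ℝ → EuclideanSpace 𝕜 (Fin n)) :
    D.traceMatrix *ᵥ Sum.elim (D.inflow v) (D.outflow v) = sys.trace v := by
  rw [traceMatrix, ← Matrix.mulVec_mulVec, exchange_mulVec, D.boundaryTransform_mulVec_effort hP1]

lemma isDecomposition_iff {K M : Matrix (Fin n) (Fin n) 𝕜} :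
    D.system.IsDecomposition K M ↔
      IsUnit K ∧ sys.WB * D.traceMatrix = K * Matrix.fromCols 1 (-M) := by
  rw [HBCS.IsDecomposition, ← D.fromCols_one_neg_mul_exchange, traceMatrix, ← Matrix.mul_assoc,
    ← Matrix.mul_assoc]
  refine and_congr_right' ⟨fun h => ?_, fun h => ?_⟩
  · change D.system.WB * _ = _
    rw [h, Matrix.mul_assoc, D.exchange_mul_self, Matrix.mul_one]
  · rw [← h, Matrix.mul_assoc _ D.exchange, D.exchange_mul_self, Matrix.mul_one]
    rfl

lemma exists_isDecomposition_of_isUnit (h : IsUnit (sys.WB * D.traceMatrix).toCols₁) :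
    ∃ K M, D.system.IsDecomposition K M := by
  set W := sys.WB * D.traceMatrix
  refine ⟨W.toCols₁, -(W.toCols₁⁻¹ * W.toCols₂), D.isDecomposition_iff.mpr ⟨h, ?_⟩⟩
  rw [neg_neg, Matrix.mul_fromCols, Matrix.mul_one,
    Matrix.mul_nonsing_inv_cancel_left _ _ ((Matrix.isUnit_iff_isUnit_det _).mp h),
    Matrix.fromCols_toCols]

/-! ### Existence of the decomposition -/

lemma exists_ne_zero_dotProduct_outflow_eq_zero (hP1 : IsUnit sys.P1) (hWB : sys.WB.rank = n)
    (h : ¬ IsUnit (sys.WB * D.traceMatrix).toCols₁) :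
    ∃ c : Fin n → 𝕜, c ≠ 0 ∧ ∀ v, sys.WB *ᵥ sys.trace v = 0 → c ⬝ᵥ D.outflow v = 0 := by
  set W := sys.WB * D.traceMatrix with hW
  rw [Matrix.isUnit_iff_isUnit_det, isUnit_iff_ne_zero, not_not] at h
  obtain ⟨w, hw0, hw⟩ := Matrix.exists_vecMul_eq_zero_iff.mpr h
  refine ⟨w ᵥ* W.toCols₂, fun hc => hw0 ?_, fun v hv => ?_⟩
  · have hwW : (w ᵥ* sys.WB) ᵥ* D.traceMatrix = 0 := by
      rw [Matrix.vecMul_vecMul, ← hW, ← Matrix.fromCols_toCols W, Matrix.vecMul_fromCols, hw, hc,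
        Sum.elim_zero_zero]
    have hwWB : w ᵥ* sys.WB = 0 :=
      Matrix.vecMul_injective_of_isUnit (D.isUnit_traceMatrix hP1)
        (hwW.trans (Matrix.zero_vecMul _).symm)
    exact vecMul_injective_of_rank_eq_card (hWB.trans (Fintype.card_fin n).symm)
      (hwWB.trans (Matrix.zero_vecMul _).symm)
  · have hflow : W.toCols₁ *ᵥ D.inflow v + W.toCols₂ *ᵥ D.outflow v = 0 := by
      rw [← Matrix.fromCols_mulVec_sumElim, Matrix.fromCols_toCols, hW, ← Matrix.mulVec_mulVec,
        D.traceMatrix_mulVec hP1, hv]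
    simpa only [dotProduct_add, Matrix.dotProduct_mulVec, hw, zero_dotProduct, zero_add,
      dotProduct_zero] using congrArg (w ⬝ᵥ ·) hflow

lemma exists_pos_le_travelTime : ∃ δ : ℝ, 0 < δ ∧ ∀ i, δ ≤ D.travelTime i := by
  rcases isEmpty_or_nonempty (Fin n) with _ | _
  · exact ⟨1, one_pos, isEmptyElim⟩
  · obtain ⟨i, hi⟩ := Finite.exists_min D.travelTime
    exact ⟨_, D.travelTime_pos i, hi⟩

lemma exists_arrival_eq (i : Fin n) {t : ℝ} (ht : t ∈ Icc 0 (D.travelTime i)) :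
    ∃ ξ ∈ Icc sys.a sys.b, D.arrival i ξ = t := by
  have hcont := (D.continuous_arrival i).continuousOn (s := Icc sys.a sys.b)
  by_cases hi : (i : ℕ) < D.m
  · refine intermediate_value_Icc sys.hab.le hcont ?_
    rwa [arrival_a, arrival_b, if_pos hi, if_pos hi]
  · refine intermediate_value_Icc' sys.hab.le hcont ?_
    rwa [arrival_a, arrival_b, if_neg hi, if_neg hi]

lemma shiftVec_eq_zero (i : Fin n) {ψ : C(ℝ, ℝ)} {t : ℝ} (hψ : ∀ s, t ≤ s → ψ s = 0) :
    D.shiftVec i ψ t = 0 := by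
  rw [shiftVec, Lp.eq_zero_iff_ae_eq_zero]
  filter_upwards [D.coeFn_testVec i _, ae_restrict_mem measurableSet_Icc] with ξ hcoe hξ
  have hψξ : ψ (t + D.arrival i ξ) = 0 := hψ _ (le_add_of_nonneg_right (D.arrival_nonneg i hξ))
  rw [hcoe]
  change ψ (t + D.arrival i ξ) • _ = _
  rw [hψξ, zero_smul]
  rfl

lemma mul_eq_zero_of_sum_smul_testVec_eq_zero {c : Fin n → 𝕜} {φ : Fin n → C(ℝ, ℝ)}
    (h : ∑ i, c i • D.testVec i (φ i) = 0) (i : Fin n) {ξ : ℝ} (hξ : ξ ∈ Icc sys.a sys.b) :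
    star (c i) * (φ i ξ : 𝕜) = 0 := by
  have hcont : Continuous fun ξ => star (c i) * (φ i ξ : 𝕜) :=
    continuous_const.mul (RCLike.continuous_ofReal.comp (φ i).continuous)
  refine Measure.eqOn_Icc_of_ae_eq volume sys.hab.ne ?_ hcont.continuousOn
    (continuousOn_const (c := (0 : 𝕜))) hξ
  have hsum : ∀ᵐ ξ ∂sys.vol, ∑ i, c i • φ i ξ • D.row i ξ = 0 := by
    have hcoe := Lp.coeFn_fun_finsetSum Finset.univ fun i => c i • D.testVec i (φ i)
    rw [h] at hcoe
    have hsmul := ae_all_iff.mpr fun i => Lp.coeFn_smul (c i) (D.testVec i (φ i))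
    have htest := ae_all_iff.mpr fun i => D.coeFn_testVec i (φ i)
    filter_upwards [hcoe, hsmul, htest, Lp.coeFn_zero (EuclideanSpace 𝕜 (Fin n)) 2 sys.vol] with
      ξ hcoe hsmul htest hzero
    simpa only [hcoe, hsmul, Pi.smul_apply, htest, Pi.zero_apply] using hzero
  filter_upwards [hsum, ae_restrict_mem measurableSet_Icc] with ξ hsum hξ
  have hinner := congrArg
    (inner 𝕜 · (WithLp.toLp 2 ((D.S ξ)⁻¹ *ᵥ Pi.single i 1) : EuclideanSpace 𝕜 (Fin n))) hsum
  simp only [RCLike.real_smul_eq_coe_smul (K := 𝕜), sum_inner, inner_smul_left, RCLike.conj_ofReal,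
    D.inner_row, Matrix.mulVec_mulVec, D.S_mul_inv hξ, Matrix.one_mulVec, Pi.single_apply, mul_ite,
    mul_one, mul_zero, Finset.sum_ite_eq', Finset.mem_univ, if_true, inner_zero_left] at hinner
  exact hinner

lemma hasDerivWithinAt_sum_mul_inner_shiftVec (hP1 : IsUnit sys.P1)
    (hP0 : ∀ᵐ ξ ∂sys.vol, D.P0D ξ = 0) {c : Fin n → 𝕜}
    (hc : ∀ v, sys.WB *ᵥ sys.trace v = 0 → c ⬝ᵥ D.outflow v = 0) {X : ℝ → sys.State}
    {z : sys.State} {t : ℝ} (hX : HasDerivWithinAt X z (Ici t) t)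
    (hXz : sys.operatorGraph (X t) z) {ψ : ℝ → ℝ} (hψ : ContDiff ℝ 1 ψ)
    (hsupp : HasCompactSupport ψ) (hψ0 : ∀ i, ψ (t + D.travelTime i) = 0) :
    HasDerivWithinAt (fun s => ∑ i, c i * inner 𝕜 (D.shiftVec i ⟨ψ, hψ.continuous⟩ s) (X s)) 0
      (Ici t) t := by
  obtain ⟨v, hev, hbc⟩ := hXz
  refine (HasDerivWithinAt.fun_sum fun i _ => HasDerivWithinAt.const_mul (c i)
    (D.hasDerivWithinAt_inner_shiftVec hP1 hP0 hX hev i hψ hsupp)).congr_deriv ?_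
  calc ∑ i, c i * ((ψ (t + D.travelTime i) : 𝕜) * D.inflow v i - (ψ t : 𝕜) * D.outflow v i)
      = -(ψ t : 𝕜) * (c ⬝ᵥ D.outflow v) := by
        rw [dotProduct, Finset.mul_sum]
        refine Finset.sum_congr rfl fun i _ => ?_
        rw [hψ0, RCLike.ofReal_zero]
        ring
    _ = 0 := by rw [hc v hbc, mul_zero]

lemma sum_smul_shiftVec_eq_zero (hP1 : IsUnit sys.P1) (hP0 : ∀ᵐ ξ ∂sys.vol, D.P0D ξ = 0)
    (hgen : GeneratesC0Semigroup 𝕜 sys.operatorGraph) {c : Fin n → 𝕜}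
    (hc : ∀ v, sys.WB *ᵥ sys.trace v = 0 → c ⬝ᵥ D.outflow v = 0) {δ : ℝ} (hδ : 0 ≤ δ)
    (hδτ : ∀ i, δ ≤ D.travelTime i) {ψ : ℝ → ℝ} (hψ : ContDiff ℝ 1 ψ)
    (hsupp : HasCompactSupport ψ) (hψδ : ∀ t, δ ≤ t → ψ t = 0) :
    ∑ i, star (c i) • D.shiftVec i ⟨ψ, hψ.continuous⟩ 0 = 0 := by
  obtain ⟨T, hT, hTG⟩ := generatesC0Semigroup_iff.mp hgen
  refine hT.dense_generatorGraph_domain.eq_zero_of_inner_left 𝕜 fun x hx => ?_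
  obtain ⟨z, hxz⟩ := hx
  let F : ℝ → 𝕜 := fun t =>
    ∑ i, c i * inner 𝕜 (D.shiftVec i ⟨ψ, hψ.continuous⟩ t) (T t.toNNReal x)
  have hF : Continuous F := continuous_finsetSum _ fun i _ => continuous_const.mul <|
    Continuous.inner (continuous_iff_continuousAt.mpr fun t =>
      (D.hasDerivAt_shiftVec i hψ hsupp t).continuousAt) (hT.continuous_orbit_toNNReal x)
  have hderiv : ∀ t ∈ Ico 0 δ, HasDerivWithinAt F 0 (Ici t) t := fun t ht =>
    D.hasDerivWithinAt_sum_mul_inner_shiftVec hP1 hP0 hc (hT.hasDerivWithinAt_orbit hxz ht.1)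
      ((hTG _ _).mpr (hT.generatorGraph_apply hxz _)) hψ hsupp
      fun i => hψδ _ ((hδτ i).trans (le_add_of_nonneg_left ht.1))
  have hconst : F δ = F 0 :=
    constant_of_has_deriv_right_zero hF.continuousOn hderiv δ (right_mem_Icc.mpr hδ)
  have hFδ : F δ = 0 := Finset.sum_eq_zero fun i _ => by
    rw [D.shiftVec_eq_zero i hψδ, inner_zero_left, mul_zero]
  simpa [F, sum_inner, inner_smul_left, hT.map_zero] using hconst.symm.trans hFδ

theorem exists_isDecomposition (hP1 : IsUnit sys.P1) (hWB : sys.WB.rank = n)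
    (hgen : GeneratesC0Semigroup 𝕜 sys.operatorGraph) (hP0 : ∀ᵐ ξ ∂sys.vol, D.P0D ξ = 0) :
    ∃ K M, D.system.IsDecomposition K M := by
  refine D.exists_isDecomposition_of_isUnit ?_
  by_contra hW
  obtain ⟨c, hc0, hc⟩ := D.exists_ne_zero_dotProduct_outflow_eq_zero hP1 hWB hW
  obtain ⟨i, hi⟩ := Function.ne_iff.mp hc0
  obtain ⟨δ, hδ, hδτ⟩ := D.exists_pos_le_travelTime
  let ψ : ContDiffBump (δ / 2) := ⟨δ / 4, δ / 2, by linarith, by linarith⟩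
  have hψδ (t : ℝ) (ht : δ ≤ t) : ψ t = 0 := by
    refine ψ.zero_of_le_dist ((?_ : δ / 2 ≤ t - δ / 2).trans (le_abs_self _))
    linarith
  obtain ⟨ξ, hξ, hξδ⟩ := D.exists_arrival_eq i (t := δ / 2) ⟨by linarith, by linarith [hδτ i]⟩
  have hzero := D.mul_eq_zero_of_sum_smul_testVec_eq_zero
    (D.sum_smul_shiftVec_eq_zero hP1 hP0 hgen hc hδ.le hδτ ψ.contDiff ψ.hasCompactSupport hψδ) i hξ
  have hψ1 : ψ (δ / 2) = 1 :=
    ψ.one_of_mem_closedBall (Metric.mem_closedBall_self ψ.rIn_pos.le)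
  refine hi ?_
  simpa [hξδ, hψ1] using hzero

end HBCS.Diagonalisation

/-! ### Linear delay equations -/

section DelayEquation

open ExpPoly

variable {ι : Type*} [Fintype ι] [DecidableEq ι]

/-- The action of matrices of exponential polynomials on vectors of functions of time. -/
def delayAction : Matrix ι ι ExpPoly →+* Module.End ℂ (ι → ℝ → ℂ) :=
  (endVecRingEquivMatrixEnd ι ℂ (ℝ → ℂ)).symm.toRingHom.comp delay.toRingHom.mapMatrix

lemma delayAction_apply (A : Matrix ι ι ExpPoly) (f : ι → ℝ → ℂ) (p : ι) (t : ℝ) :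
    delayAction A f p t = ∑ q, delay (A p q) (f q) t :=
  Finset.sum_apply t _ _

lemma delayAction_delayMatrix_apply (M : Matrix ι ι ℂ) (τ : ι → ℝ≥0) (f : ι → ℝ → ℂ) (p : ι)
    (t : ℝ) : delayAction (delayMatrix M τ) f p t = ∑ q, M p q * f q (t - τ q) := by
  simp only [delayAction_apply, delayMatrix, Matrix.of_apply, delay_single]

lemma norm_delayAction_le (A : Matrix ι ι ExpPoly) {f : ι → ℝ → ℂ} {t B : ℝ}
    (hf : ∀ s ≤ t, ∀ q, ‖f q s‖ ≤ B) (p : ι) :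
    ‖delayAction A f p t‖ ≤ (∑ q, ‖A p q‖) * B := by
  rw [delayAction_apply, Finset.sum_mul]
  exact (norm_sum_le _ _).trans (Finset.sum_le_sum fun q _ => norm_delay_le _ fun s hs => hf s hs q)

lemma delayAction_pow_eq_zero (M : Matrix ι ι ℂ) {τ : ι → ℝ≥0} {δ : ℝ} (hδ : ∀ i, δ ≤ τ i)
    {f : ι → ℝ → ℂ} (hf : ∀ p, ∀ t ≤ 0, f p t = 0) (N : ℕ) (p : ι) {t : ℝ} (ht : t ≤ N * δ) :
    (delayAction (delayMatrix M τ) ^ N) f p t = 0 := by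
  induction N generalizing p t with
  | zero => exact hf p t (by simpa using ht)
  | succ N ih =>
    rw [pow_succ', Module.End.mul_apply, delayAction_delayMatrix_apply]
    refine Finset.sum_eq_zero fun q _ => ?_
    rw [Nat.cast_succ, add_one_mul] at ht
    rw [ih q (by linarith [hδ q]), mul_zero]

/-- Since all delays are bounded below, the Neumann series of a delay equation with zero history
is a finite sum at each time. -/
lemma exists_eq_sum_delayAction_sub (M : Matrix ι ι ℂ) {τ : ι → ℝ≥0} {δ : ℝ} (hδ0 : 0 < δ)
    (hδ : ∀ i, δ ≤ τ i) {F : ι → ℝ → ℂ} (hF : ∀ p, ∀ t ≤ 0, F p t = 0) (t : ℝ) :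
    ∃ N : ℕ, ∀ p, F p t = ∑ k ∈ Finset.range N,
      delayAction (delayMatrix M τ ^ k) (F - delayAction (delayMatrix M τ) F) p t := by
  set L := delayAction (delayMatrix M τ) with hL
  obtain ⟨N, hN⟩ := exists_nat_ge (t / δ)
  have hgeom : ∑ k ∈ Finset.range N, (L ^ k) (F - L F) = F - (L ^ N) F := by
    simpa using LinearMap.congr_fun (geom_sum_mul_neg L N) F
  refine ⟨N, fun p => ?_⟩
  have hzero : (L ^ N) F p t = 0 := delayAction_pow_eq_zero M hδ hF N p ((div_le_iff₀ hδ0).mp hN)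
  have hval := congrFun (congrFun hgeom p) t
  simp only [Finset.sum_apply, Pi.sub_apply, hzero, sub_zero] at hval
  simp only [map_pow, ← hL, hval]

lemma norm_le_of_delay_equation {M : Matrix ι ι ℂ} {τ : ι → ℝ≥0} {δ : ℝ} (hδ0 : 0 < δ)
    (hδ : ∀ i, δ ≤ τ i) (hM : ∀ p q, Summable fun k : ℕ => ‖(delayMatrix M τ ^ k) p q‖)
    {F : ι → ℝ → ℂ} (hF : ∀ p, ∀ t ≤ 0, F p t = 0) {t B : ℝ} (hB : 0 ≤ B)
    (hFB : ∀ s ≤ t, ∀ p, ‖F p s - ∑ q, M p q * F q (s - τ q)‖ ≤ B) (p : ι) :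
    ‖F p t‖ ≤ (∑ q, ∑' k : ℕ, ‖(delayMatrix M τ ^ k) p q‖) * B := by
  obtain ⟨N, hN⟩ := exists_eq_sum_delayAction_sub M hδ0 hδ hF t
  have hbound (k : ℕ) := norm_delayAction_le (delayMatrix M τ ^ k)
    (f := F - delayAction (delayMatrix M τ) F) (t := t) (B := B)
    (fun s hs q => by
      simpa only [Pi.sub_apply, delayAction_delayMatrix_apply] using hFB s hs q) p
  calc ‖F p t‖ ≤ ∑ k ∈ Finset.range N, (∑ q, ‖(delayMatrix M τ ^ k) p q‖) * B := by
        rw [hN p]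
        exact (norm_sum_le _ _).trans (Finset.sum_le_sum fun k _ => hbound k)
    _ = (∑ q, ∑ k ∈ Finset.range N, ‖(delayMatrix M τ ^ k) p q‖) * B := by
        rw [Finset.sum_comm, Finset.sum_mul]
    _ ≤ (∑ q, ∑' k : ℕ, ‖(delayMatrix M τ ^ k) p q‖) * B :=
        mul_le_mul_of_nonneg_right (Finset.sum_le_sum fun q _ =>
          (hM p q).sum_le_tsum _ fun _ _ => norm_nonneg _) hB

end DelayEquation

/-! ### Outflow as delayed inflow -/

lemma eq_comp_sub_of_forall_integral_eq_zero {E : Type*} [NormedAddCommGroup E] [NormedSpace ℝ E]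
    [CompleteSpace E] {F G : ℝ → E} (hF : Continuous F) (hG : Continuous G) (τ : ℝ)
    (h : ∀ ψ : ℝ → ℝ, ContDiff ℝ ∞ ψ → HasCompactSupport ψ →
      ∫ t, (ψ (t + τ) • F t - ψ t • G t) = 0) (t : ℝ) : G t = F (t - τ) := by
  have hFτ : Continuous fun t => F (t - τ) := hF.comp (continuous_id.sub continuous_const)
  have hcont : Continuous fun t => F (t - τ) - G t := hFτ.sub hG
  have hae : ∀ᵐ t, F (t - τ) - G t = 0 := by
    refine ae_eq_zero_of_integral_contDiff_smul_eq_zero hcont.locallyIntegrable fun ψ hψ hsupp => ?_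
    have hint {f : ℝ → E} (hf : Continuous f) : Integrable fun t => ψ t • f t :=
      (hψ.continuous.smul hf).integrable_of_hasCompactSupport hsupp.smul_right
    have hshift : Integrable fun t => ψ (t + τ) • F t := by
      simpa using (hint hFτ).comp_add_right τ
    rw [← h ψ hψ hsupp, integral_sub hshift (hint hG)]
    simp_rw [smul_sub]
    rw [integral_sub (hint hFτ) (hint hG)]
    congr 1
    rw [← integral_add_right_eq_self _ τ]
    simp
  have hzero := (hcont.ae_eq_iff_eq volume continuous_const).mp hae
  exact (sub_eq_zero.mp (congrFun hzero t)).symm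

lemma exists_pos_forall_le_eq_zero {ψ : ℝ → ℝ} (hsupp : HasCompactSupport ψ) :
    ∃ R : ℝ, 0 < R ∧ ∀ t, R ≤ t → ψ t = 0 := by
  obtain ⟨R, hR⟩ := hsupp.isCompact.bddAbove
  refine ⟨max (R + 1) 1, lt_max_of_lt_right one_pos, fun t ht => ?_⟩
  refine image_eq_zero_of_notMem_tsupport fun hmem => ?_
  linarith [hR hmem, le_of_max_le_left ht]

lemma HBCS.trace_eq_zero_of_evolution_zero {𝕜 : Type*} [RCLike 𝕜] {n : ℕ} {sys : HBCS 𝕜 n}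
    {z : sys.State} {v : ℝ → EuclideanSpace 𝕜 (Fin n)} (hev : sys.Evolution 0 z v) :
    sys.trace v = 0 := by
  obtain ⟨w, ⟨hw, hv⟩, hx, -⟩ := hev
  have hvw : HasWeakDerivOn v w sys.a sys.b :=
    ⟨(intervalIntegrable_iff_integrableOn_Icc_of_le sys.hab.le).mpr (hw.integrable one_le_two), hv⟩
  have hae : v =ᵐ[sys.vol] 0 := by
    filter_upwards [hx, Lp.coeFn_zero (EuclideanSpace 𝕜 (Fin n)) 2 sys.vol] with ξ hξ hzero
    rw [hzero, Pi.zero_apply, WithLp.ofLp_zero, Matrix.mulVec_zero] at hξ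
    exact (WithLp.ofLp_eq_zero 2).mp hξ
  have hvc : ContinuousOn v (Icc sys.a sys.b) :=
    uIcc_of_le sys.hab.le ▸ (hvw.absolutelyContinuousOnInterval sys.hab.le).continuousOn
  have hzero := Measure.eqOn_Icc_of_ae_eq volume sys.hab.ne hae hvc continuousOn_const
  rw [trace, hzero (left_mem_Icc.mpr sys.hab.le), hzero (right_mem_Icc.mpr sys.hab.le)]
  exact Sum.elim_zero_zero

namespace HBCS.Diagonalisation

variable {𝕜 : Type*} [RCLike 𝕜] {n : ℕ} {sys : HBCS 𝕜 n} (D : sys.Diagonalisation)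

lemma sumElim_inflow_outflow (hP1 : IsUnit sys.P1) (v : ℝ → EuclideanSpace 𝕜 (Fin n)) :
    Sum.elim (D.inflow v) (D.outflow v) = D.traceMatrix⁻¹ *ᵥ sys.trace v := by
  rw [← D.traceMatrix_mulVec hP1, Matrix.mulVec_mulVec,
    Matrix.nonsing_inv_mul _ ((Matrix.isUnit_iff_isUnit_det _).mp (D.isUnit_traceMatrix hP1)),
    Matrix.one_mulVec]

lemma sumElim_inflow_outflow_eq_zero (hP1 : IsUnit sys.P1) {z : sys.State}
    {v : ℝ → EuclideanSpace 𝕜 (Fin n)} (hev : sys.Evolution 0 z v) :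
    Sum.elim (D.inflow v) (D.outflow v) = 0 := by
  rw [D.sumElim_inflow_outflow hP1, trace_eq_zero_of_evolution_zero hev, Matrix.mulVec_zero]

lemma continuous_inflow {T : Type*} [TopologicalSpace T] (hP1 : IsUnit sys.P1)
    {v : T → ℝ → EuclideanSpace 𝕜 (Fin n)} (hv : Continuous fun t => sys.trace (v t)) (i : Fin n) :
    Continuous fun t => D.inflow (v t) i := by
  have hflow (t : T) : D.inflow (v t) i = (D.traceMatrix⁻¹ *ᵥ sys.trace (v t)) (Sum.inl i) :=
    congrFun (D.sumElim_inflow_outflow hP1 (v t)) (Sum.inl i)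
  simp_rw [hflow]
  exact (continuous_apply _).comp (continuous_const.matrix_mulVec hv)

lemma continuous_outflow {T : Type*} [TopologicalSpace T] (hP1 : IsUnit sys.P1)
    {v : T → ℝ → EuclideanSpace 𝕜 (Fin n)} (hv : Continuous fun t => sys.trace (v t)) (i : Fin n) :
    Continuous fun t => D.outflow (v t) i := by
  have hflow (t : T) : D.outflow (v t) i = (D.traceMatrix⁻¹ *ᵥ sys.trace (v t)) (Sum.inr i) :=
    congrFun (D.sumElim_inflow_outflow hP1 (v t)) (Sum.inr i)
  simp_rw [hflow]
  exact (continuous_apply _).comp (continuous_const.matrix_mulVec hv)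

section Trajectory

variable {X Z : ℝ → sys.State} {v : ℝ → ℝ → EuclideanSpace 𝕜 (Fin n)}

lemma integral_flow_eq_zero (hP1 : IsUnit sys.P1) (hP0 : ∀ᵐ ξ ∂sys.vol, D.P0D ξ = 0)
    (hXc : ContinuousOn X (Ici 0)) (hX : ∀ t, 0 ≤ t → HasDerivWithinAt X (Z t) (Ici t) t)
    (hev : ∀ t, 0 ≤ t → sys.Evolution (X t) (Z t) (v t)) (hX0 : X 0 = 0)
    (htrace : Continuous fun t => sys.trace (v (max t 0))) (i : Fin n)
    {ψ : ℝ → ℝ} (hψ : ContDiff ℝ 1 ψ) (hsupp : HasCompactSupport ψ) :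
    ∫ t, (ψ (t + D.travelTime i) • D.inflow (v (max t 0)) i -
      ψ t • D.outflow (v (max t 0)) i) = 0 := by
  obtain ⟨R, hR0, hR⟩ := exists_pos_forall_le_eq_zero hsupp
  have hcont : ContinuousOn (fun t => inner 𝕜 (D.shiftVec i ⟨ψ, hψ.continuous⟩ t) (X t))
      (Icc 0 R) :=
    ContinuousOn.inner (fun t _ =>
      (D.hasDerivAt_shiftVec i hψ hsupp t).continuousAt.continuousWithinAt)
      (hXc.mono Icc_subset_Ici_self)
  set rate : ℝ → 𝕜 := fun t => ψ (t + D.travelTime i) • D.inflow (v (max t 0)) i -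
    ψ t • D.outflow (v (max t 0)) i with hrate
  have hderiv : ∀ t ∈ Ioo 0 R, HasDerivWithinAt
      (fun t => inner 𝕜 (D.shiftVec i ⟨ψ, hψ.continuous⟩ t) (X t)) (rate t) (Ioi t) t :=
    fun t ht => by
    simp only [hrate, RCLike.real_smul_eq_coe_mul, max_eq_left ht.1.le]
    exact (D.hasDerivWithinAt_inner_shiftVec hP1 hP0 (hX t ht.1.le) (hev t ht.1.le) i hψ
      hsupp).mono Ioi_subset_Ici_self
  have hrate_cont : Continuous rate :=
    ((hψ.continuous.comp (continuous_id.add continuous_const)).smul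
      (D.continuous_inflow hP1 htrace i)).sub
      (hψ.continuous.smul (D.continuous_outflow hP1 htrace i))
  have hrate_supp : Function.support rate ⊆ Ioc 0 R := by
    refine Function.support_subset_iff'.mpr fun t ht => ?_
    rcases le_or_gt t 0 with h0 | h0
    · have hzero := D.sumElim_inflow_outflow_eq_zero hP1 (hX0 ▸ hev 0 le_rfl)
      have hin : D.inflow (v 0) i = 0 := congrFun hzero (Sum.inl i)
      have hout : D.outflow (v 0) i = 0 := congrFun hzero (Sum.inr i)
      simp only [hrate, max_eq_right h0, hin, hout, smul_zero, sub_zero]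
    · have htR : R < t := not_le.mp fun htR => ht ⟨h0, htR⟩
      have hshift : ψ (t + D.travelTime i) = 0 := hR _ (by linarith [D.travelTime_pos i])
      simp only [hrate, hR t htR.le, hshift, zero_smul, sub_zero]
  rw [← intervalIntegral.integral_eq_integral_of_support_subset hrate_supp,
    intervalIntegral.integral_eq_sub_of_hasDeriv_right_of_le hR0.le hcont hderiv
      (hrate_cont.intervalIntegrable _ _), hX0, D.shiftVec_eq_zero i hR, inner_zero_left,
    inner_zero_right, sub_zero]

theorem outflow_eq_inflow_sub_travelTime (hP1 : IsUnit sys.P1)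
    (hP0 : ∀ᵐ ξ ∂sys.vol, D.P0D ξ = 0) (hXc : ContinuousOn X (Ici 0))
    (hX : ∀ t, 0 ≤ t → HasDerivWithinAt X (Z t) (Ici t) t)
    (hev : ∀ t, 0 ≤ t → sys.Evolution (X t) (Z t) (v t)) (hX0 : X 0 = 0)
    (htrace : Continuous fun t => sys.trace (v (max t 0))) (i : Fin n) (t : ℝ) :
    D.outflow (v (max t 0)) i = D.inflow (v (max (t - D.travelTime i) 0)) i :=
  eq_comp_sub_of_forall_integral_eq_zero (D.continuous_inflow hP1 htrace i)
    (D.continuous_outflow hP1 htrace i) _ (fun _ hψ hsupp =>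
      D.integral_flow_eq_zero hP1 hP0 hXc hX hev hX0 htrace i (hψ.of_le (mod_cast le_top)) hsupp) t

end Trajectory

end HBCS.Diagonalisation

/-! ### BIBO stability -/

section EssentialSupremum

variable {E : Type*} [NormedAddCommGroup E] {u : ℝ → E} {a b : ℝ}

lemma eLpNorm_top_Icc_lt_top_of_continuousOn (hu : ContinuousOn u (Icc a b)) :
    eLpNorm u ⊤ (volume.restrict (Icc a b)) < ⊤ := by
  obtain ⟨C, hC⟩ := isCompact_Icc.exists_bound_of_continuousOn hu
  exact (memLp_top_of_bound (hu.aestronglyMeasurable measurableSet_Icc) C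
    (ae_restrict_of_forall_mem measurableSet_Icc hC)).2

lemma norm_le_toReal_eLpNorm_top_of_continuousOn (hab : a ≠ b) (hu : ContinuousOn u (Icc a b))
    {s : ℝ} (hs : s ∈ Icc a b) : ‖u s‖ ≤ (eLpNorm u ⊤ (volume.restrict (Icc a b))).toReal := by
  set B := (eLpNorm u ⊤ (volume.restrict (Icc a b))).toReal with hB
  have hae : (fun s => max ‖u s‖ B) =ᵐ[volume.restrict (Icc a b)] fun _ => B := by
    filter_upwards [ae_le_eLpNormEssSup (f := u) (μ := volume.restrict (Icc a b))] with s hs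
    rw [max_eq_right_iff, hB, ← toReal_enorm]
    exact ENNReal.toReal_mono (eLpNorm_top_Icc_lt_top_of_continuousOn hu).ne hs
  exact max_eq_right_iff.mp <| Measure.eqOn_Icc_of_ae_eq volume hab hae
    (hu.norm.sup continuousOn_const) continuousOn_const hs

lemma eLpNorm_top_Icc_le_of_forall_norm_le {F : Type*} [NormedAddCommGroup F] {y : ℝ → F} {c : ℝ}
    (hab : a ≠ b) (hu : ContinuousOn u (Icc a b)) (hc : 0 ≤ c)
    (h : ∀ B, 0 ≤ B → (∀ s ∈ Icc a b, ‖u s‖ ≤ B) → ∀ s ∈ Icc a b, ‖y s‖ ≤ c * B) :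
    eLpNorm y ⊤ (volume.restrict (Icc a b)) ≤
      ENNReal.ofReal c * eLpNorm u ⊤ (volume.restrict (Icc a b)) := by
  rw [← ENNReal.ofReal_toReal (eLpNorm_top_Icc_lt_top_of_continuousOn hu).ne,
    ← ENNReal.ofReal_mul hc, eLpNorm_exponent_top]
  exact eLpNormEssSup_le_of_ae_bound <| ae_restrict_of_forall_mem measurableSet_Icc <|
    h _ ENNReal.toReal_nonneg fun _ => norm_le_toReal_eLpNorm_top_of_continuousOn hab hu

end EssentialSupremum

section Complexify

variable {𝕜 : Type*} [RCLike 𝕜]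

lemma norm_map_complex (x : 𝕜) : ‖RCLike.map 𝕜 ℂ x‖ = ‖x‖ := by
  simp

lemma map_complex_mul (x y : 𝕜) :
    RCLike.map 𝕜 ℂ (x * y) = RCLike.map 𝕜 ℂ x * RCLike.map 𝕜 ℂ y := by
  apply Complex.ext <;> simp

lemma norm_le_of_complexify_delay_equation {n : ℕ} {M : Matrix (Fin n) (Fin n) 𝕜}
    {τ : Fin n → ℝ≥0} {δ : ℝ} (hδ0 : 0 < δ) (hδ : ∀ i, δ ≤ τ i)
    (hM : ∀ p q, Summable fun k : ℕ => ‖(delayMatrix (complexify M) τ ^ k) p q‖)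
    {F : Fin n → ℝ → 𝕜} (hF : ∀ p, ∀ t ≤ 0, F p t = 0) {t B : ℝ} (hB : 0 ≤ B)
    (hFB : ∀ s ≤ t, ∀ p, ‖F p s - ∑ q, M p q * F q (s - τ q)‖ ≤ B) (p : Fin n) :
    ‖F p t‖ ≤ (∑ q, ∑' k : ℕ, ‖(delayMatrix (complexify M) τ ^ k) p q‖) * B := by
  rw [← norm_map_complex]
  refine norm_le_of_delay_equation hδ0 hδ hM (F := fun p s => RCLike.map 𝕜 ℂ (F p s))
    (fun p s hs => by rw [hF p s hs, map_zero]) hB (fun s hs q => ?_) p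
  refine le_of_eq_of_le ?_ (hFB s hs q)
  rw [← norm_map_complex (F q s - _), map_sub, map_sum]
  simp only [map_complex_mul, complexify, Matrix.map_apply]

end Complexify

lemma norm_mulVec_ofLp_le_normInftyInfty {𝕜 : Type*} [RCLike 𝕜] {n : ℕ}
    (A : Matrix (Fin n) (Fin n) 𝕜) (v : EuclideanSpace 𝕜 (Fin n)) :
    ‖A *ᵥ v.ofLp‖ ≤ normInftyInfty A * ‖v‖ := by
  refine (ContinuousLinearMap.le_opNorm (LinearMap.toContinuousLinearMap A.mulVecLin) v.ofLp).trans
    (mul_le_mul_of_nonneg_left ?_ (norm_nonneg _))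
  exact (pi_norm_le_iff_of_nonneg (norm_nonneg v)).mpr (PiLp.norm_apply_le v)

lemma HBCS.continuous_trace {𝕜 : Type*} [RCLike 𝕜] {n : ℕ} {sys : HBCS 𝕜 n}
    (hW : (Matrix.fromRows sys.WB sys.WC).rank = n + n) {T : Type*} [TopologicalSpace T]
    {u y : T → EuclideanSpace 𝕜 (Fin n)} {v : T → ℝ → EuclideanSpace 𝕜 (Fin n)}
    (hu : Continuous u) (hy : Continuous y) (huv : ∀ t, (u t).ofLp = sys.WB *ᵥ sys.trace (v t))
    (hyv : ∀ t, (y t).ofLp = sys.WC *ᵥ sys.trace (v t)) :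
    Continuous fun t => sys.trace (v t) := by
  set N := Matrix.fromRows sys.WB sys.WC with hN
  have hunit : IsUnit N := Matrix.vecMul_injective_iff_isUnit.mp <|
    vecMul_injective_of_rank_eq_card (hW.trans (by rw [Fintype.card_sum, Fintype.card_fin]))
  have htrace (t : T) : sys.trace (v t) = N⁻¹ *ᵥ Sum.elim (u t).ofLp (y t).ofLp := by
    rw [huv t, hyv t, ← Matrix.fromRows_mulVec, ← hN, Matrix.mulVec_mulVec,
      Matrix.nonsing_inv_mul _ ((Matrix.isUnit_iff_isUnit_det _).mp hunit), Matrix.one_mulVec]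
  simp_rw [htrace]
  refine continuous_const.matrix_mulVec (continuous_pi ?_)
  rintro (j | j)
  exacts [(PiLp.continuous_apply 2 _ j).comp hu, (PiLp.continuous_apply 2 _ j).comp hy]

namespace HBCS.Diagonalisation

variable {𝕜 : Type*} [RCLike 𝕜] {n : ℕ} {sys : HBCS 𝕜 n} (D : sys.Diagonalisation)

/-- The inflow and the delayed inflow at time `t`, as the argument of `traceMatrix`. -/
def delayedPair (F : Fin n → ℝ → 𝕜) (t : ℝ) : Fin n ⊕ Fin n → 𝕜 :=
  Sum.elim (fun i => F i t) fun i => F i (t - D.travelTime i)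

lemma exists_inflow_of_isClassicalSolution (hP1 : IsUnit sys.P1)
    (hP0 : ∀ᵐ ξ ∂sys.vol, D.P0D ξ = 0) (hW : (Matrix.fromRows sys.WB sys.WC).rank = n + n)
    {u y : ℝ → EuclideanSpace 𝕜 (Fin n)} {x : ℝ → sys.State}
    (hsol : sys.IsClassicalSolution u x y) (hx0 : x 0 = 0) :
    ∃ F : Fin n → ℝ → 𝕜, (∀ i, ∀ t ≤ 0, F i t = 0) ∧ ∀ t, 0 ≤ t →
      (u t).ofLp = (sys.WB * D.traceMatrix) *ᵥ D.delayedPair F t ∧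
      (y t).ofLp = (sys.WC * D.traceMatrix) *ᵥ D.delayedPair F t := by
  obtain ⟨hu, hx, hy, hsol⟩ := hsol
  choose! v hev huv hyv using hsol
  have hderiv : ∀ t, 0 ≤ t → HasDerivWithinAt x (derivWithin x (Ici 0) t) (Ici t) t := fun t ht =>
    (hx.differentiableOn one_ne_zero t ht).hasDerivWithinAt.mono (Ici_subset_Ici.mpr ht)
  have hmax (t : ℝ) : max t 0 ∈ Ici (0 : ℝ) := le_max_right t 0
  have hmaxc : Continuous fun t : ℝ => max t 0 := continuous_id.max continuous_const
  have htrace : Continuous fun t => sys.trace (v (max t 0)) :=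
    continuous_trace hW (hu.comp_continuous hmaxc hmax) (hy.comp_continuous hmaxc hmax)
      (fun t => huv _ (hmax t)) fun t => hyv _ (hmax t)
  have hpair : ∀ t, 0 ≤ t → D.traceMatrix *ᵥ D.delayedPair (fun i s => D.inflow (v (max s 0)) i) t =
      sys.trace (v t) := fun t ht => by
    rw [← D.traceMatrix_mulVec hP1 (v t), delayedPair]
    simp only [← D.outflow_eq_inflow_sub_travelTime hP1 hP0 hx.continuousOn hderiv hev hx0 htrace,
      max_eq_left ht]
  refine ⟨fun i t => D.inflow (v (max t 0)) i, fun i t ht => ?_, fun t ht => ?_⟩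
  · simp only [max_eq_right ht]
    exact congrFun (D.sumElim_inflow_outflow_eq_zero hP1 (hx0 ▸ hev 0 le_rfl)) (Sum.inl i)
  · rw [← Matrix.mulVec_mulVec, ← Matrix.mulVec_mulVec, hpair t ht]
    exact ⟨huv t ht, hyv t ht⟩

variable {D} in
lemma inv_mulVec_input {K M : Matrix (Fin n) (Fin n) 𝕜} (hKM : D.system.IsDecomposition K M)
    (f g : Fin n → 𝕜) :
    K⁻¹ *ᵥ ((sys.WB * D.traceMatrix) *ᵥ Sum.elim f g) = f - M *ᵥ g := by
  obtain ⟨hK, hWB⟩ := D.isDecomposition_iff.mp hKM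
  rw [hWB, Matrix.mulVec_mulVec, ← Matrix.mul_assoc,
    Matrix.nonsing_inv_mul _ ((Matrix.isUnit_iff_isUnit_det _).mp hK), Matrix.one_mul,
    Matrix.fromCols_mulVec_sumElim, Matrix.one_mulVec, Matrix.neg_mulVec, sub_eq_add_neg]

/-- A bound for the `L^∞`-gain from the input to the inflow. -/
def inflowGain (K M : Matrix (Fin n) (Fin n) 𝕜) : ℝ :=
  (∑ p, ∑ q, ∑' k : ℕ, ‖(delayMatrix (complexify M) D.delays ^ k) p q‖) * normInftyInfty K⁻¹

lemma inflowGain_nonneg (K M : Matrix (Fin n) (Fin n) 𝕜) : 0 ≤ D.inflowGain K M :=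
  mul_nonneg (Finset.sum_nonneg fun _ _ => Finset.sum_nonneg fun _ _ =>
    tsum_nonneg fun _ => norm_nonneg _) (norm_nonneg _)

lemma norm_inflow_le {K M : Matrix (Fin n) (Fin n) 𝕜} (hKM : D.system.IsDecomposition K M)
    (hsum : ∀ p q, Summable fun k : ℕ => ‖(delayMatrix (complexify M) D.delays ^ k) p q‖)
    {u : ℝ → EuclideanSpace 𝕜 (Fin n)} {F : Fin n → ℝ → 𝕜} (hF : ∀ i, ∀ t ≤ 0, F i t = 0)
    (huF : ∀ t, 0 ≤ t → (u t).ofLp = (sys.WB * D.traceMatrix) *ᵥ D.delayedPair F t) {t B : ℝ}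
    (hB : 0 ≤ B) (huB : ∀ s ∈ Icc 0 t, ‖u s‖ ≤ B) (p : Fin n) :
    ‖F p t‖ ≤ D.inflowGain K M * B := by
  obtain ⟨δ, hδ0, hδ⟩ := D.exists_pos_le_travelTime
  have hKB : 0 ≤ normInftyInfty K⁻¹ * B := mul_nonneg (norm_nonneg _) hB
  have hforcing : ∀ s ≤ t, ∀ p, ‖F p s - ∑ q, M p q * F q (s - D.delays q)‖ ≤
      normInftyInfty K⁻¹ * B := fun s hst p => by
    rcases lt_or_ge s 0 with hs | hs
    · have hpast (q : Fin n) : F q (s - D.delays q) = 0 :=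
        hF q _ (by linarith [(D.delays q).coe_nonneg])
      simpa only [hF p s hs.le, hpast, mul_zero, Finset.sum_const_zero, sub_zero, norm_zero]
    · have hinput : F p s - ∑ q, M p q * F q (s - D.delays q) = (K⁻¹ *ᵥ (u s).ofLp) p := by
        rw [huF s hs, delayedPair, inv_mulVec_input hKM]
        rfl
      rw [hinput]
      exact (norm_le_pi_norm _ p).trans ((norm_mulVec_ofLp_le_normInftyInfty _ _).trans
        (mul_le_mul_of_nonneg_left (huB s ⟨hs, hst⟩) (norm_nonneg _)))
  refine (norm_le_of_complexify_delay_equation hδ0 hδ hsum hF hKB hforcing p).trans ?_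
  rw [inflowGain, mul_assoc]
  exact mul_le_mul_of_nonneg_right (Finset.single_le_sum
    (f := fun p => ∑ q, ∑' k : ℕ, ‖(delayMatrix (complexify M) D.delays ^ k) p q‖)
    (fun _ _ => Finset.sum_nonneg fun _ _ => tsum_nonneg fun _ => norm_nonneg _)
    (Finset.mem_univ p)) hKB

theorem bibo_of_summable (hP1 : IsUnit sys.P1) (hP0 : ∀ᵐ ξ ∂sys.vol, D.P0D ξ = 0)
    (hW : (Matrix.fromRows sys.WB sys.WC).rank = n + n) {K M : Matrix (Fin n) (Fin n) 𝕜}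
    (hKM : D.system.IsDecomposition K M)
    (hsum : ∀ p q, Summable fun k : ℕ => ‖(delayMatrix (complexify M) D.delays ^ k) p q‖) :
    sys.BIBOStable := by
  let γ : (Fin n ⊕ Fin n → 𝕜) →L[𝕜] EuclideanSpace 𝕜 (Fin n) := LinearMap.toContinuousLinearMap
    ((WithLp.linearEquiv 2 𝕜 (Fin n → 𝕜)).symm.toLinearMap ∘ₗ (sys.WC * D.traceMatrix).mulVecLin)
  have hgain : 0 ≤ ‖γ‖ * D.inflowGain K M := mul_nonneg (norm_nonneg γ) (D.inflowGain_nonneg K M)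
  refine ⟨‖γ‖ * D.inflowGain K M + 1, by linarith, fun u x y hsol _ _ hx0 t ht => ?_⟩
  obtain ⟨F, hF, hio⟩ := D.exists_inflow_of_isClassicalSolution hP1 hP0 hW hsol hx0
  refine eLpNorm_top_Icc_le_of_forall_norm_le ht.ne (hsol.1.mono Icc_subset_Ici_self)
    (by linarith) fun B hB huB s hs => ?_
  have hflow : ∀ r ≤ s, ∀ i, ‖F i r‖ ≤ D.inflowGain K M * B := fun r hr i =>
    D.norm_inflow_le hKM hsum hF (fun t ht => (hio t ht).1) hB
      (fun q hq => huB q ⟨hq.1, hq.2.trans (hr.trans hs.2)⟩) i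
  have hpair : ‖D.delayedPair F s‖ ≤ D.inflowGain K M * B := by
    refine (pi_norm_le_iff_of_nonneg (mul_nonneg (D.inflowGain_nonneg K M) hB)).mpr ?_
    rintro (i | i)
    exacts [hflow s le_rfl i, hflow _ (sub_le_self s (D.travelTime_pos i).le) i]
  have hy : y s = γ (D.delayedPair F s) := WithLp.ofLp_injective 2 (hio s hs.1).2
  calc ‖y s‖ ≤ ‖γ‖ * (D.inflowGain K M * B) := by
        rw [hy]
        exact (γ.le_opNorm _).trans (mul_le_mul_of_nonneg_left hpair (norm_nonneg γ))
    _ ≤ (‖γ‖ * D.inflowGain K M + 1) * B := by linarith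

/-! ### The diagonalised system is its own diagonalisation -/

/-- The trivial diagonalisation, with `S = 1`, of the diagonalised system. Through it, the results
on the original system also apply to the diagonalised one. -/
def self : D.system.Diagonalisation where
  m := D.m
  m_le := D.m_le
  S := fun _ => 1
  h := D.h
  S_contDiff := fun _ _ => contDiffOn_const
  S_unit := fun _ _ => isUnit_one
  h_contDiff := D.h_contDiff
  h_pos := D.h_pos
  eq := ae_of_all _ fun ξ => by
    rw [inv_one, Matrix.one_mul, Matrix.mul_one]
    rfl

lemma self_boundaryTransform : D.self.boundaryTransform = 1 := by
  have hblock : (P1D 𝕜 n D.m)⁻¹ * (1 : Matrix (Fin n) (Fin n) 𝕜)⁻¹ * P1D 𝕜 n D.m = 1 := by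
    rw [inv_one, Matrix.mul_one, Matrix.inv_eq_right_inv (P1D_mul_self D.m), P1D_mul_self]
  exact (congr_arg₂ (Matrix.fromBlocks · 0 0 ·) hblock hblock).trans Matrix.fromBlocks_one

lemma self_P0D (hP0 : ∀ᵐ ξ ∂sys.vol, D.P0D ξ = 0) : ∀ᵐ ξ ∂D.system.vol, D.self.P0D ξ = 0 := by
  have hderiv (ξ : ℝ) : D.self.derivSInv ξ = 0 :=
    Matrix.ext fun i j => congrFun
      (derivWithin_fun_const (Icc sys.a sys.b) ((1 : Matrix (Fin n) (Fin n) 𝕜)⁻¹ i j)) ξ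
  filter_upwards [show ∀ᵐ ξ ∂D.system.vol, D.system.P0 ξ = 0 from hP0] with ξ hξ
  rw [P0D, hderiv, hξ, Matrix.zero_mul, Matrix.zero_mul, add_zero, Matrix.mul_zero,
    Matrix.zero_mul]

variable {D} in
lemma self_isDecomposition {K M : Matrix (Fin n) (Fin n) 𝕜} (hKM : D.system.IsDecomposition K M) :
    D.self.system.IsDecomposition K M := by
  have hWB : D.self.system.WB = D.system.WB :=
    (congrArg (D.system.WB * ·) D.self_boundaryTransform).trans (Matrix.mul_one _)
  exact ⟨hKM.1, hWB.trans hKM.2⟩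

lemma system_rank (hP1 : IsUnit sys.P1) :
    (Matrix.fromRows D.system.WB D.system.WC).rank = (Matrix.fromRows sys.WB sys.WC).rank := by
  change (Matrix.fromRows (sys.WB * D.boundaryTransform) (sys.WC * D.boundaryTransform)).rank = _
  rw [← Matrix.fromRows_mul, Matrix.rank_mul_eq_left_of_isUnit_det _ _
    ((Matrix.isUnit_iff_isUnit_det _).mp (D.isUnit_boundaryTransform hP1))]

theorem system_bibo_of_summable (hP1 : IsUnit sys.P1) (hP0 : ∀ᵐ ξ ∂sys.vol, D.P0D ξ = 0)
    (hW : (Matrix.fromRows sys.WB sys.WC).rank = n + n) {K M : Matrix (Fin n) (Fin n) 𝕜}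
    (hKM : D.system.IsDecomposition K M)
    (hsum : ∀ p q, Summable fun k : ℕ => ‖(delayMatrix (complexify M) D.delays ^ k) p q‖) :
    D.system.BIBOStable :=
  D.self.bibo_of_summable (IsUnit.of_mul_eq_one _ (P1D_mul_self D.m)) (D.self_P0D hP0)
    ((D.system_rank hP1).trans hW) (self_isDecomposition hKM) hsum

end HBCS.Diagonalisation

end

theorem mainTheorem1_general {𝕜 : Type*} [RCLike 𝕜] {n : ℕ} {sys : HBCS 𝕜 n}
    (hP1 : IsUnit sys.P1) (hW : (Matrix.fromRows sys.WB sys.WC).rank = n + n)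
    (D : sys.Diagonalisation) (hP0 : ∀ᵐ ξ ∂sys.vol, D.P0D ξ = 0) :
    (GeneratesC0Semigroup 𝕜 sys.operatorGraph →
      ∃ K M : Matrix (Fin n) (Fin n) 𝕜, D.system.IsDecomposition K M) ∧
    ∀ K M : Matrix (Fin n) (Fin n) 𝕜, D.system.IsDecomposition K M →
      ((normInftyInfty M < 1 ∨
        (Summable fun k : ℕ => absMatrix M ^ k) ∨
        (∃ k₀ : ℕ, 0 < k₀ ∧ ∀ p, ∑ r, D.system.powVariation M k₀ p r < 1)) →
        (∀ p q, ∑' k : ℕ, D.system.powVariation M k p q < ⊤) ∧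
        D.system.BIBOStable ∧ sys.BIBOStable) ∧
      ((∃ ν : AlgebraNorm 𝕜 (Matrix (Fin n) (Fin n) 𝕜), ν (absMatrix M) < 1) →
        Summable fun k : ℕ => absMatrix M ^ k) := by
  have hWB : sys.WB.rank = n :=
    (rank_eq_card_of_rank_fromRows (by rwa [Fintype.card_fin])).trans (Fintype.card_fin n)
  refine ⟨fun hgen => D.exists_isDecomposition hP1 hWB hgen hP0, fun K M hKM =>
    ⟨fun hM => ?_, fun ⟨ν, hν⟩ => summable_pow_of_algebraNorm_lt_one ν hν⟩⟩
  have hsum := D.summable_norm_delayMatrix_delays_pow hP0 hM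
  refine ⟨fun p q => ?_, D.system_bibo_of_summable hP1 hP0 hW hKM hsum,
    D.bibo_of_summable hP1 hP0 hW hKM hsum⟩
  simp_rw [D.powVariation_system hP0]
  rw [← ENNReal.ofReal_tsum_of_nonneg (fun _ => norm_nonneg _) (hsum p q)]
  exact ENNReal.ofReal_lt_top

theorem mainTheorem1 {𝕜 : Type*} [RCLike 𝕜] {n : ℕ} (sys : HBCS 𝕜 n) (hsys : sys.Admissible)
    (D : sys.Diagonalisation) (hP0 : ∀ᵐ ξ ∂sys.vol, D.P0D ξ = 0) :
    (∃ K M : Matrix (Fin n) (Fin n) 𝕜, D.system.IsDecomposition K M) ∧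
    ∀ K M : Matrix (Fin n) (Fin n) 𝕜, D.system.IsDecomposition K M →
      ((normInftyInfty M < 1 ∨
        (Summable fun k : ℕ => absMatrix M ^ k) ∨
        (∃ k₀ : ℕ, 0 < k₀ ∧ ∀ p, ∑ r, D.system.powVariation M k₀ p r < 1)) →
        (∀ p q, ∑' k : ℕ, D.system.powVariation M k p q < ⊤) ∧
        D.system.BIBOStable ∧ sys.BIBOStable) ∧
      ((∃ ν : AlgebraNorm 𝕜 (Matrix (Fin n) (Fin n) 𝕜), ν (absMatrix M) < 1) →
        Summable fun k : ℕ => absMatrix M ^ k) :=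
  have hgeneral := mainTheorem1_general hsys.P1_unit hsys.WBC_rank D hP0
  ⟨hgeneral.1 hsys.generates, hgeneral.2⟩
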